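/- Let $q$ be a prime power, $F=\mathbb F_{q^2}$, and let $F[x,y]=F[X,Y]/(X^{q+1}-Y^q-Y)$ be the coordinate ring of the Hermitian curve, with quotient field $F(x,y)$. The monomials $x^ay^b$ ($a\ge 0$, $0\le b<q$) form an $F$-basis of $F[x,y]$; write $h_{a,b}$ for the coefficients of $h\in F[x,y]$ in it. Put $\rho(h)=\max\{aq+b(q+1): h_{a,b}\ne 0\}$, $\rho(0)=-\infty$, and extend to $F(x,y)$ by $\rho(h/h')=\rho(h)-\rho(h')$. Let $z^*_0=y^{q-1}+1$ and $z^*_b=y^{q-1-b}$ for $0<b<q$. Every element of $F(x,y)$ is uniquely $\sum_{b=0}^{q-1}h_bz^*_b$ with $h_b\in F(x)$; expanding each $h_b$ as a Laurent series in $1/x$ writes it as a sum of terms $c\,x^az^*_b$ ($a\in\mathbb Z$, $c\in F$) of order $aq+q^2-1-b(q+1)$. An element is called monic if its term of largest order has coefficient $1$. Let $e=(e_P)$ be a vector over $F$ indexed by the $q^3$ points $P=(\alpha_P,\beta_P)\in F^2$ with $\alpha_P^{q+1}=\beta_P^q+\beta_P$. Put $s_{a,b}=\sum_P e_P\alpha_P^a\beta_P^b$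 for $a\ge 0$ (with $0^0=1$), $s_{a,b}=0$ for $a<0$, and $$S=\sum_P e_P\frac{x^{q+1}-\alpha_P^{q+1}}{(x-\alpha_P)(y-\beta_P)}\in F(x,y).$$ For $K\in\mathbb Z$, a pair $f,\varphi\in F[x,y]$ with $f\neq 0$ solves the $K$-th approximation of the key equation if $\rho(fS-\varphi)\le q^2-q-1-K$ and $\varphi$, written in the basis $(z^*_b)$, is a sum of terms of order at least $q^2-q-K$. By convention, the pairs $0,\ \pm x^{-a-1}z^*_b$ with $a<0$, $0\le b<q$ also solve it, for $K=aq+b(q+1)$, and no other pair with $f=0$ does. Define $f_i^{(m)},\varphi_i^{(m)},g_i^{(m)},\psi_i^{(m)}\in F[x,y]$ for $m\ge 0$, $0\le i<q$, as follows. Initially $f_i^{(0)}=y^i$, $\varphi_i^{(0)}=0$, $g_i^{(0)}=0$, $\psi_i^{(0)}=-z^*_i$. Given the data for $m$, for each $i$ let $j\in\{0,\dots,q-1\}$ be the index with $i+j\equiv m \pmod q$, and let $$d_i=\rho(f_i^{(m)}),\quad r_i=\frac{m-d_i-j(q+1)}{q},\quad \tilde f_i=y^jf_i^{(m)},\quad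 \mu_i=\sum_{c=0}^{q-1}\sum_a(\tilde f_i)_{a,c}\,s_{a+r_i,c},\quad p=\frac{d_i+d_j-m}{q}-1,$$ $$\begin{pmatrix}f_i^{(m+1)}&\varphi_i^{(m+1)}\\ g_j^{(m+1)}&\psi_j^{(m+1)}\end{pmatrix}=U_i^{(m)}\begin{pmatrix}f_i^{(m)}&\varphi_i^{(m)}\\ g_j^{(m)}&\psi_j^{(m)}\end{pmatrix},\qquad U_i^{(m)}=\begin{cases}\begin{pmatrix}1&-\mu_ix^p\\0&1\end{pmatrix}&\text{if }\mu_i=0\text{ or }p\ge 0,\\[2ex]\begin{pmatrix}x^{-p}&-\mu_i\\1/\mu_i&0\end{pmatrix}&\text{otherwise.}\end{cases}$$ Then for every $m\ge 0$ and every $0\le i<q$: 1. $f_i^{(m)}$ is monic and $\rho(f_i^{(m)})\equiv i \pmod q$ (so $r_i$ and $p$ are always integers); 2. $f_i^{(m)},\varphi_i^{(m)}$ solve the $(m-\rho(f_i^{(m)}))$-th approximation of the key equation; 3. $g_i^{(m)},\psi_i^{(m)}$ solve the $(\rho(f_i^{(m)})-q)$-th approximation of the key equation, and $g_i^{(m)}S-\psi_i^{(m)}$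 is monic of order $q^2-1-\rho(f_i^{(m)})$; 4. $\rho(g_i^{(m)})<m-\rho(f_i^{(m)})+q$. -/

import Mathlib

open Polynomial

namespace Hermitian

noncomputable section

/-! ### The Hermitian curve `X^(q+1) = Y^q + Y` -/

/-- The polynomial `Y^q + Y - X^(q+1)`, as a polynomial in `Y` over `F[X]`. -/
def curvePoly (F : Type*) [Field F] (q : ℕ) : F[X][X] :=
  X ^ q + X - C (X ^ (q + 1))

theorem one_lt_q (q : ℕ) [hq : Fact (IsPrimePow q)] : 1 < q := hq.out.one_lt

theorem curvePoly_monic (F : Type*) [Field F] (q : ℕ) [Fact (IsPrimePow q)] :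
    (curvePoly F q).Monic := by
  have hq := one_lt_q q
  have h : (X - C (X ^ (q + 1)) : F[X][X]).degree < (q : WithBot ℕ) := by
    rw [degree_X_sub_C]
    exact_mod_cast hq
  have := monic_X_pow_add (n := q) h
  rwa [← add_sub_assoc] at this

/-- Irreducibility by Eisenstein's criterion at the prime `Y`, with the variables exchanged. -/
theorem curvePoly_irreducible (F : Type*) [Field F] (q : ℕ) [Fact (IsPrimePow q)] :
    Irreducible (curvePoly F q) := by
  have hq := one_lt_q q
  rw [← MulEquiv.irreducible_iff (Bivariate.swap (R := F)).toMulEquiv]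
  have e : (Bivariate.swap (R := F)).toMulEquiv (curvePoly F q) =
      -(X ^ (q + 1) - C (X ^ q + X) : F[X][X]) := by
    change Bivariate.swap (curvePoly F q) = _
    rw [curvePoly, map_sub, map_add, map_pow, Bivariate.swap_Y, C_pow, map_pow,
      Bivariate.swap_X, C_add, C_pow]
    ring
  rw [e]
  refine Associated.irreducible (p := (X ^ (q + 1) - C (X ^ q + X) : F[X][X]))
    ⟨-1, by rw [Units.val_neg, Units.val_one, mul_neg, mul_one]⟩ ?_
  have hm : (X ^ (q + 1) - C (X ^ q + X) : F[X][X]).Monic := monic_X_pow_sub_C _ (by omega)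
  have hp : (Ideal.span {(X : F[X])}).IsPrime :=
    (Ideal.span_singleton_prime X_ne_zero).2 prime_X
  have hd : (X ^ (q + 1) - C (X ^ q + X) : F[X][X]).natDegree = q + 1 := natDegree_X_pow_sub_C
  refine irreducible_of_eisenstein_criterion hp ?_ ?_ ?_ ?_ hm.isPrimitive
  · rw [hm.leadingCoeff]
    exact fun h => hp.ne_top ((Ideal.eq_top_iff_one _).2 h)
  · intro n hn
    rw [degree_eq_natDegree hm.ne_zero, hd] at hn
    have hn' : n < q + 1 := by exact_mod_cast hn
    rw [coeff_sub, coeff_X_pow, if_neg (by omega), coeff_C]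
    split_ifs
    · rw [zero_sub, neg_mem_iff, Ideal.mem_span_singleton]
      exact dvd_add (dvd_pow_self _ (by omega)) dvd_rfl
    · simp
  · rw [degree_eq_natDegree hm.ne_zero, hd]
    exact_mod_cast Nat.succ_pos q
  · rw [coeff_sub, coeff_X_pow, if_neg (by omega), coeff_C, if_pos rfl, zero_sub, neg_mem_iff,
      Ideal.span_singleton_pow, Ideal.mem_span_singleton]
    intro h
    rw [X_pow_dvd_iff] at h
    have := h 1 (by omega)
    rw [coeff_add, coeff_X_pow, coeff_X_one, if_neg (by omega)] at this
    simp at this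

/-- The coordinate ring `F[x,y] = F[X,Y]/(X^(q+1) - Y^q - Y)`. -/
abbrev CoordRing (F : Type*) [Field F] (q : ℕ) : Type _ := AdjoinRoot (curvePoly F q)

instance (F : Type*) [Field F] (q : ℕ) [Fact (IsPrimePow q)] : IsDomain (CoordRing F q) :=
  AdjoinRoot.isDomain_of_prime (curvePoly_irreducible F q).prime

/-- The function field `F(x,y)`. -/
abbrev FunField (F : Type*) [Field F] (q : ℕ) : Type _ := FractionRing (CoordRing F q)

section Defs

variable {F : Type*} [Field F] {q : ℕ}

/-- The class `x` of `X`. -/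
def x : CoordRing F q := AdjoinRoot.of (curvePoly F q) X

/-- The class `y` of `Y`. -/
def y : CoordRing F q := AdjoinRoot.root (curvePoly F q)

variable [Fact (IsPrimePow q)]

/-- `coef f a b` is the coefficient of `x^a y^b` in the expansion of `f` in the monomial basis
`x^a y^b`, `0 ≤ a`, `0 ≤ b < q`, of `F[x,y]` over `F`. -/
def coef (f : CoordRing F q) (a b : ℕ) : F :=
  ((AdjoinRoot.modByMonicHom (curvePoly_monic F q) f).coeff b).coeff a

/-- The finitely many `a` for which `x^a y^b` occurs in `f`. -/
def xSupport (f : CoordRing F q) (b : ℕ) : Finset ℕ :=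
  ((AdjoinRoot.modByMonicHom (curvePoly_monic F q) f).coeff b).support

/-- The order function on `F[x,y]`: the maximum of `aq + b(q+1)` over the monomials `x^a y^b`
that occur in `f`, with `rho 0 = ⊥`. -/
def rho (f : CoordRing F q) : WithBot ℤ :=
  (Finset.range q).sup fun b => (xSupport f b).sup fun a =>
    (((a * q + b * (q + 1) : ℕ) : ℤ) : WithBot ℤ)

/-- The order of a nonzero element of `F[x,y]` as an integer. -/
def ord (f : CoordRing F q) : ℤ := (rho f).unbotD 0

/-- The order function on `F(x,y)`: `rho (f/g) = rho f - rho g`. -/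
def rhoFrac (h : FunField F q) : WithBot ℤ :=
  rho (IsLocalization.sec (nonZeroDivisors (CoordRing F q)) h).1 +
    ((-ord ((IsLocalization.sec (nonZeroDivisors (CoordRing F q)) h).2 : CoordRing F q) : ℤ) :
      WithBot ℤ)

/-! ### The `∗`-basis -/

/-- The `∗`-basis: `z∗_0 = y^(q-1) + 1` and `z∗_b = y^(q-1-b)` for `0 < b < q`. -/
def zstar (b : Fin q) : CoordRing F q :=
  if (b : ℕ) = 0 then y ^ (q - 1) + 1 else y ^ (q - 1 - (b : ℕ))

/-- The order `aq + q² - 1 - b(q+1)` of the term `x^a z∗_b`, `a` an integer. -/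
def termOrder (a : ℤ) (b : Fin q) : ℤ := a * q + ((q : ℤ) ^ 2 - 1 - (b : ℕ) * (q + 1))

/-- The embedding of `F(x)` into `F(x,y)`. -/
def ofRatFunc (h : RatFunc F) : FunField F q :=
  h.eval (algebraMap F (FunField F q)) (algebraMap (CoordRing F q) (FunField F q) x)

/-- The coefficient of `x^a`, `a` an integer, in the expansion of `h ∈ F(x)` as a Laurent series
in `T = 1/x`. -/
def laurentCoeff (h : RatFunc F) (a : ℤ) : F :=
  (h.eval (HahnSeries.C : F →+* LaurentSeries F) (HahnSeries.single (-1 : ℤ) (1 : F))).coeff (-a)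

/-- `c` is the family of coordinates of `h` in the `∗`-basis of `F(x,y)` over `F(x)`. -/
def IsStarExpansion (h : FunField F q) (c : Fin q → RatFunc F) : Prop :=
  h = ∑ b : Fin q, ofRatFunc (c b) * algebraMap (CoordRing F q) (FunField F q) (zstar b)

/-- `h` is monic in the `∗`-basis: the coefficient of its leading term `x^a z∗_b`, the one of
largest order, is `1`. -/
def IsStarMonic (h : FunField F q) : Prop :=
  ∃ c : Fin q → RatFunc F, IsStarExpansion h c ∧
    ∃ (a : ℤ) (b : Fin q), laurentCoeff (c b) a = 1 ∧
      ∀ (a' : ℤ) (b' : Fin q), laurentCoeff (c b') a' ≠ 0 → termOrder a' b' ≤ termOrder a b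

/-- `φ`, written in the `∗`-basis, is a sum of terms of order at least `N`. -/
def StarTermsAtLeast (φ : CoordRing F q) (N : ℤ) : Prop :=
  ∃ c : Fin q → RatFunc F, IsStarExpansion (algebraMap (CoordRing F q) (FunField F q) φ) c ∧
    ∀ (a : ℤ) (b : Fin q), laurentCoeff (c b) a ≠ 0 → N ≤ termOrder a b

/-! ### Approximations of the key equation -/

/-- The element `fS - φ` of `F(x,y)`. -/
def keyDiff (S : FunField F q) (f φ : CoordRing F q) : FunField F q :=
  algebraMap (CoordRing F q) (FunField F q) f * S - algebraMap (CoordRing F q) (FunField F q) φ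

/-- `f, φ` solve the `K`-th approximation of the key equation for `S`. For `f = 0` the solutions
are, by convention, `φ = ± x^(-a-1) z∗_b` with `a < 0` and `K = aq + b(q+1)`. -/
def SolvesKeyEq (S : FunField F q) (K : ℤ) (f φ : CoordRing F q) : Prop :=
  (f ≠ 0 ∧ rhoFrac (keyDiff S f φ) ≤ (((q : ℤ) ^ 2 - q - 1 - K : ℤ) : WithBot ℤ) ∧
      StarTermsAtLeast φ ((q : ℤ) ^ 2 - q - K)) ∨
  (f = 0 ∧ ∃ (a : ℤ) (b : Fin q), a < 0 ∧ K = a * q + (b : ℕ) * (q + 1) ∧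
      (φ = x ^ (-a - 1).toNat * zstar b ∨ φ = -(x ^ (-a - 1).toNat * zstar b)))

end Defs

/-! ### Syndromes -/

/-- The `F`-rational points `(α, β)` of the affine Hermitian curve. -/
def Point (F : Type*) [Field F] (q : ℕ) : Type _ :=
  {P : F × F // P.1 ^ (q + 1) = P.2 ^ q + P.2}

instance (F : Type*) [Field F] [Finite F] (q : ℕ) : Finite (Point F q) :=
  inferInstanceAs (Finite {P : F × F // P.1 ^ (q + 1) = P.2 ^ q + P.2})

instance (F : Type*) [Field F] [Finite F] (q : ℕ) : Fintype (Point F q) := Fintype.ofFinite _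

section Algorithm

variable {F : Type*} [Field F] [Finite F] {q : ℕ}

/-- The syndrome values `s_(a,b) = ∑ e_P α^a β^b` for `a ≥ 0`, and `s_(a,b) = 0` for `a < 0`. -/
def synd (e : Point F q → F) (a : ℤ) (b : ℕ) : F :=
  if 0 ≤ a then ∑ P : Point F q, e P * P.1.1 ^ a.toNat * P.1.2 ^ b else 0

variable [Fact (IsPrimePow q)]

/-- The syndrome `S = ∑ e_P (x^(q+1) - α^(q+1)) / ((x - α)(y - β))` in `F(x,y)`. -/
def syndrome (e : Point F q → F) : FunField F q :=
  ∑ P : Point F q, algebraMap F (FunField F q) (e P) *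
    ((algebraMap (CoordRing F q) (FunField F q) x ^ (q + 1)
        - algebraMap F (FunField F q) P.1.1 ^ (q + 1)) /
      ((algebraMap (CoordRing F q) (FunField F q) x - algebraMap F (FunField F q) P.1.1) *
        (algebraMap (CoordRing F q) (FunField F q) y - algebraMap F (FunField F q) P.1.2)))

/-! ### The decoding algorithm -/

/-- The polynomials `f_i, φ_i, g_i, ψ_i`, `0 ≤ i < q`, that the algorithm maintains. -/
structure State (F : Type*) [Field F] (q : ℕ) where
  f : Fin q → CoordRing F q
  φ : Fin q → CoordRing F q
  g : Fin q → CoordRing F q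
  ψ : Fin q → CoordRing F q

/-- The index `j` with `0 ≤ j < q` and `i + j ≡ m mod q`. -/
def partner (m : ℕ) (i : Fin q) : Fin q :=
  ⟨(m + (q - (i : ℕ))) % q, Nat.mod_lt _ i.pos⟩

/-- `d_i`. -/
def State.d (s : State F q) (i : Fin q) : ℤ := ord (s.f i)

/-- `r_i = (m - d_i - j(q+1)) / q`. -/
def State.r (s : State F q) (m : ℕ) (i : Fin q) : ℤ :=
  ((m : ℤ) - s.d i - (partner m i : ℕ) * (q + 1)) / q

/-- `μ_i = ∑_c ∑_a (y^j f_i)_(a,c) s_(a + r_i, c)`. -/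
def State.μ (e : Point F q → F) (s : State F q) (m : ℕ) (i : Fin q) : F :=
  ∑ c ∈ Finset.range q, ∑ a ∈ xSupport (y ^ (partner m i : ℕ) * s.f i) c,
    coef (y ^ (partner m i : ℕ) * s.f i) a c * synd e ((a : ℤ) + s.r m i) c

/-- `p = (d_i + d_j - m) / q - 1`. -/
def State.p (s : State F q) (m : ℕ) (i : Fin q) : ℤ :=
  (s.d i + s.d (partner m i) - m) / q - 1

open Classical in
/-- The matrix `U_i`. -/
def State.U (e : Point F q → F) (s : State F q) (m : ℕ) (i : Fin q) :
    Matrix (Fin 2) (Fin 2) (CoordRing F q) :=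
  if s.μ e m i = 0 ∨ 0 ≤ s.p m i then
    !![1, -(algebraMap F (CoordRing F q) (s.μ e m i) * x ^ (s.p m i).toNat); 0, 1]
  else
    !![x ^ (-s.p m i).toNat, -algebraMap F (CoordRing F q) (s.μ e m i);
      algebraMap F (CoordRing F q) (s.μ e m i)⁻¹, 0]

/-- The product of `U_i` with the matrix with rows `f_i, φ_i` and `g_j, ψ_j`. -/
def State.B (e : Point F q → F) (s : State F q) (m : ℕ) (i : Fin q) :
    Matrix (Fin 2) (Fin 2) (CoordRing F q) :=
  s.U e m i * !![s.f i, s.φ i; s.g (partner m i), s.ψ (partner m i)]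

/-- Iteration `m`. The first row of `U_i B` is the new `f_i, φ_i` and its second row the new
`g_j, ψ_j`; hence the new `g_i, ψ_i` are the second row for the partner `j` of `i`, whose own
partner is `i`. -/
def State.step (e : Point F q → F) (s : State F q) (m : ℕ) : State F q where
  f i := s.B e m i 0 0
  φ i := s.B e m i 0 1
  g i := s.B e m (partner m i) 1 0
  ψ i := s.B e m (partner m i) 1 1

/-- The data after `m` iterations, with initial value `f_i = y^i`, `φ_i = 0`, `g_i = 0`,
`ψ_i = -z∗_i`. -/
def run (e : Point F q → F) : ℕ → State F q
  | 0 => { f := fun i => y ^ (i : ℕ), φ := fun _ => 0, g := fun _ => 0, ψ := fun i => -zstar i }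
  | m + 1 => (run e m).step e m

end Algorithm

theorem partner_spec {q : ℕ} (m : ℕ) (i : Fin q) : (i : ℕ) + partner m i ≡ m [MOD q] := by
  have hi := i.isLt
  change (i + (m + (q - i)) % q) % q = m % q
  rw [Nat.add_mod_mod, show (i : ℕ) + (m + (q - i)) = m + q by omega, Nat.add_mod_right]

theorem partner_partner {q : ℕ} (m : ℕ) (i : Fin q) : partner m (partner m i) = i := by
  have h : (partner m (partner m i) : ℕ) ≡ i [MOD q] := by
    refine Nat.ModEq.add_left_cancel' (partner m i : ℕ) ?_
    exact (partner_spec m (partner m i)).trans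
      ((partner_spec m i).symm.trans (by rw [Nat.add_comm]))
  exact Fin.ext (h.eq_of_lt_of_lt (Fin.isLt _) i.isLt)

end

end Hermitian

/-! The curve has a single point at infinity, with local parameter t = x/y. There x and y have poles
of orders q and q+1, both with leading coefficient 1. The monomials x^a y^b with b < q have pairwise
distinct pole orders, and so do the terms x^a z∗_b. Hence `rho` is the pole order, and being monic
means having leading coefficient 1 in F((t)), in either basis. All claims on orders and monicity
thus become statements `LeadAt` about Laurent series.

The arithmetic input is a duality: y^b z∗_c has coordinate 1 at z∗_0 if b = c and 0 otherwise. Since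
the ∗-coordinates of S are ∑ e_P β_P^b/(x - α_P), with the s_(a,b) as Laurent coefficients, the sum
μ_i computed by the algorithm is exactly the coefficient of f_i S - φ_i at the largest order still
allowed (`discrepancy_eq`, `Invariant.lead_diff_μ`).

The proof is an induction on m. Let d_i be the order of f_i. The leading term of f_i S - φ_i, with
coefficient μ_i, is cancelled against the monic g_j S - ψ_j; the two allowed orders differ by pq,
and the bound on the order of g_j protects the leading term of f_i (`leadAt_cancel`). If μ_i ≠ 0 and
p < 0, then f_i has to be multiplied by x^(-p), its order becomes m + q - d_j, and the old f_i/μ_i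
takes the place of g_j. For this to be consistent, the orders of f_i and f_j must change together.
That is `discrepancy_symm`: f_j(f_i S - φ_i) - f_i(f_j S - φ_j) lies in F[x,y], whose elements have
polynomial coordinates, so its coefficient μ_i - μ_j at x^p z∗_0 vanishes for p < 0. -/

namespace Hermitian

noncomputable section

/-! ### Leading terms of Laurent series -/

/-- `h = a T^n + (terms of higher order)`; the coefficient `a` may vanish. -/
def LeadAt {F : Type*} [Field F] (h : LaurentSeries F) (n : ℤ) (a : F) : Prop :=
  h.coeff n = a ∧ ∀ k < n, h.coeff k = 0

namespace LeadAt

variable {F : Type*} [Field F] {h h' : LaurentSeries F} {n n' : ℤ} {a a' : F}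

/-- Writing h as T^n times a power series turns products and inverses into statements about constant
coefficients. -/
theorem iff_exists_powerSeries :
    LeadAt h n a ↔ ∃ P : PowerSeries F, PowerSeries.constantCoeff P = a ∧
      h = HahnSeries.single n 1 * (P : LaurentSeries F) := by
  constructor
  · rintro ⟨h0, h1⟩
    refine ⟨PowerSeries.mk fun k => h.coeff (n + k), by simpa using h0, ?_⟩
    ext k
    rw [HahnSeries.coeff_single_mul, one_mul, PowerSeries.coeff_coe]
    split_ifs with hk
    · exact h1 k (by omega)
    · rw [PowerSeries.coeff_mk]
      congr 1
      omega
  · rintro ⟨P, rfl, rfl⟩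
    refine ⟨?_, fun k hk => ?_⟩
    · rw [HahnSeries.coeff_single_mul, one_mul, PowerSeries.coeff_coe]
      simp
    · rw [HahnSeries.coeff_single_mul, one_mul, PowerSeries.coeff_coe, if_pos (by omega)]

theorem unique (h1 : LeadAt h n a) (h2 : LeadAt h n a') : a = a' := h1.1.symm.trans h2.1

theorem zero (n : ℤ) : LeadAt (0 : LaurentSeries F) n 0 := ⟨rfl, fun _ _ => rfl⟩

theorem single (n : ℤ) (a : F) : LeadAt (HahnSeries.single n a) n a :=
  ⟨HahnSeries.coeff_single_same _ _, fun _ hk => HahnSeries.coeff_single_of_ne hk.ne⟩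

theorem const (a : F) : LeadAt (HahnSeries.C a) 0 a := single 0 a

theorem one : LeadAt (1 : LaurentSeries F) 0 1 := const 1

theorem add (h1 : LeadAt h n a) (h2 : LeadAt h' n a') : LeadAt (h + h') n (a + a') :=
  ⟨by rw [HahnSeries.coeff_add, h1.1, h2.1],
    fun k hk => by rw [HahnSeries.coeff_add, h1.2 k hk, h2.2 k hk, add_zero]⟩

theorem neg (h1 : LeadAt h n a) : LeadAt (-h) n (-a) :=
  ⟨by rw [HahnSeries.coeff_neg, h1.1], fun k hk => by rw [HahnSeries.coeff_neg, h1.2 k hk, neg_zero]⟩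

theorem sub (h1 : LeadAt h n a) (h2 : LeadAt h' n a') : LeadAt (h - h') n (a - a') := by
  rw [sub_eq_add_neg, sub_eq_add_neg]
  exact h1.add h2.neg

theorem of_lt (h1 : LeadAt h n a) (hn : n' < n) : LeadAt h n' 0 :=
  ⟨h1.2 _ hn, fun k hk => h1.2 k (hk.trans hn)⟩

/-- Once the coefficient at the allowed order is cancelled, the bound improves by one; this is the
gain of one iteration. -/
theorem succ (h1 : LeadAt h n 0) : ∃ α, LeadAt h (n + 1) α := by
  refine ⟨_, rfl, fun k hk => ?_⟩
  rcases (Int.lt_add_one_iff.1 hk).eq_or_lt with rfl | hk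
  exacts [h1.1, h1.2 k hk]

theorem ne_zero (h1 : LeadAt h n a) (ha : a ≠ 0) : h ≠ 0 := by
  rintro rfl
  exact ha (h1.unique (zero n))

theorem mul (h1 : LeadAt h n a) (h2 : LeadAt h' n' a') : LeadAt (h * h') (n + n') (a * a') := by
  obtain ⟨P, rfl, rfl⟩ := iff_exists_powerSeries.1 h1
  obtain ⟨Q, rfl, rfl⟩ := iff_exists_powerSeries.1 h2
  refine iff_exists_powerSeries.2 ⟨P * Q, map_mul _ _ _, ?_⟩
  rw [PowerSeries.coe_mul, mul_mul_mul_comm, HahnSeries.single_mul_single, one_mul]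

theorem pow (h1 : LeadAt h n a) (k : ℕ) : LeadAt (h ^ k) (k * n) (a ^ k) := by
  induction k with
  | zero => simpa using one
  | succ k ih =>
    rw [pow_succ, pow_succ, show ((k + 1 : ℕ) : ℤ) * n = k * n + n by push_cast; ring]
    exact ih.mul h1

theorem inv (h1 : LeadAt h n a) (ha : a ≠ 0) : LeadAt h⁻¹ (-n) a⁻¹ := by
  obtain ⟨P, rfl, rfl⟩ := iff_exists_powerSeries.1 h1
  refine iff_exists_powerSeries.2 ⟨P⁻¹, PowerSeries.constantCoeff_inv _, ?_⟩
  refine inv_eq_of_mul_eq_one_right ?_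
  rw [mul_mul_mul_comm, HahnSeries.single_mul_single, ← PowerSeries.coe_mul,
    PowerSeries.mul_inv_cancel _ ha]
  simp

theorem div (h1 : LeadAt h n a) (h2 : LeadAt h' n' a') (ha : a' ≠ 0) :
    LeadAt (h / h') (n - n') (a / a') := by
  rw [div_eq_mul_inv, div_eq_mul_inv, sub_eq_add_neg]
  exact h1.mul (h2.inv ha)

theorem eq_of_ne_zero (h1 : LeadAt h n a) (ha : a ≠ 0) (h2 : LeadAt h n' a') (ha' : a' ≠ 0) :
    n = n' := by
  rcases lt_trichotomy n n' with hn | hn | hn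
  · exact absurd (h1.unique (h2.of_lt hn)) ha
  · exact hn
  · exact absurd (h2.unique (h1.of_lt hn)) ha'

theorem sum_zero {ι : Type*} (s : Finset ι) {u : ι → LaurentSeries F}
    (hu : ∀ b ∈ s, LeadAt (u b) n 0) : LeadAt (∑ b ∈ s, u b) n 0 := by
  classical
  induction s using Finset.induction_on with
  | empty => simpa using zero n
  | insert b s hb ih =>
    rw [Finset.sum_insert hb, ← add_zero (0 : F)]
    exact (hu b (Finset.mem_insert_self _ _)).add
      (ih fun c hc => hu c (Finset.mem_insert_of_mem hc))

/-- A finite sum of series of pairwise distinct orders is dominated by one of them. -/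
theorem exists_dominant {ι : Type*} {s : Finset ι} (hs : s.Nonempty) {u : ι → LaurentSeries F}
    {n : ι → ℤ} {a : ι → F} (hu : ∀ b ∈ s, LeadAt (u b) (n b) (a b)) (hn : Set.InjOn n s) :
    ∃ b ∈ s, (∀ c ∈ s, n b ≤ n c) ∧ LeadAt (∑ c ∈ s, u c) (n b) (a b) := by
  classical
  obtain ⟨b, hb, hmin⟩ := s.exists_min_image n hs
  refine ⟨b, hb, hmin, ?_⟩
  rw [← Finset.add_sum_erase s u hb, ← add_zero (a b)]
  refine (hu b hb).add (sum_zero _ fun c hc => ?_)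
  have hc' := Finset.mem_of_mem_erase hc
  refine (hu c hc').of_lt ((hmin c hc').lt_of_ne fun h => Finset.ne_of_mem_erase hc ?_)
  exact (hn hb hc' h).symm

/-- The leading term of a polynomial expression in a series of negative order. -/
theorem eval₂ {ξ : LaurentSeries F} {k : ℤ} (hξ : LeadAt ξ (-k) 1) (hk : 0 < k) (p : F[X]) :
    LeadAt (p.eval₂ HahnSeries.C ξ) (-(k * p.natDegree)) p.leadingCoeff := by
  rw [eval₂_eq_sum_range, Finset.sum_range_succ, ← zero_add p.leadingCoeff]
  have hterm (j : ℕ) : LeadAt (HahnSeries.C (p.coeff j) * ξ ^ j) (-(k * j)) (p.coeff j) := by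
    have := (const (p.coeff j)).mul (hξ.pow j)
    rwa [one_pow, mul_one, zero_add, mul_neg, mul_comm (j : ℤ)] at this
  refine (sum_zero _ fun j hj => (hterm j).of_lt ?_).add (hterm _)
  have : (j : ℤ) < p.natDegree := by exact_mod_cast Finset.mem_range.1 hj
  nlinarith

end LeadAt

/-! ### Expansion at the point at infinity -/

section Expansion

theorem algebraMap_eq_of_C (F : Type*) [Field F] (q : ℕ) (a : F) :
    algebraMap F (CoordRing F q) a = AdjoinRoot.of (curvePoly F q) (C a) := rfl

variable (F : Type*) [Field F] (q : ℕ) [Fact (IsPrimePow q)]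

/-- A solution of `w ^ q + w = t ^ (q + 1)` in `F⟦t⟧`, the expansion of `1 / y` in `t = x / y`. -/
theorem exists_yInv : ∃ w : LaurentSeries F, w ^ q + w = HahnSeries.single ((q : ℤ) + 1) 1 ∧
    LeadAt w (q + 1) 1 := by
  have hq := one_lt_q q
  let f : (PowerSeries F)[X] := X ^ q + X - C (PowerSeries.X ^ (q + 1))
  have hf : f.Monic := by
    have h : (X - C (PowerSeries.X ^ (q + 1)) : (PowerSeries F)[X]).degree < (q : WithBot ℕ) := by
      rw [degree_X_sub_C]
      exact_mod_cast hq
    have := monic_X_pow_add (n := q) h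
    rwa [← add_sub_assoc] at this
  -- Dividing the curve equation by y^(q+1) gives w^q + w = t^(q+1) for w = 1/y. Hensel's lemma
  -- lifts the root 0 modulo t, where the derivative is 1 because q > 1.
  obtain ⟨w, hw, hw0⟩ := HenselianRing.is_henselian
    (I := (Ideal.span {PowerSeries.X} : Ideal (PowerSeries F))) f hf 0
    (by
      simp only [f, eval_sub, eval_add, eval_pow, eval_X, eval_C]
      rw [zero_pow (by omega), zero_add, zero_sub, neg_mem_iff, Ideal.mem_span_singleton]
      exact dvd_pow_self _ (by omega))
    (by
      have : eval 0 (derivative f) = 1 := by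
        simp only [f, derivative_sub, derivative_add, derivative_X_pow, derivative_X,
          derivative_C, sub_zero, eval_add, eval_mul, eval_pow, eval_X, eval_one,
          zero_pow (show q - 1 ≠ 0 by omega), mul_zero, zero_add]
      rw [this, map_one]
      exact isUnit_one)
  rw [sub_zero, Ideal.mem_span_singleton, PowerSeries.X_dvd_iff] at hw0
  have hw' : w ^ q + w = PowerSeries.X ^ (q + 1) := by
    have : eval w f = 0 := hw
    simp only [f, eval_sub, eval_add, eval_pow, eval_X, eval_C] at this
    exact sub_eq_zero.1 this
  have hcoe : (w : LaurentSeries F) ^ q + (w : LaurentSeries F) = HahnSeries.single ((q : ℤ) + 1) 1 := by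
    have := congrArg (HahnSeries.ofPowerSeries ℤ F) hw'
    rw [map_add, map_pow, HahnSeries.ofPowerSeries_X_pow] at this
    simpa using this
  refine ⟨w, hcoe, ?_⟩
  -- The equation reads w(w^(q-1) + 1) = t^(q+1), and the second factor is a unit with constant term
  -- 1.
  have hu : LeadAt ((w ^ (q - 1) + 1 : PowerSeries F) : LaurentSeries F) 0 1 := by
    refine LeadAt.iff_exists_powerSeries.2 ⟨w ^ (q - 1) + 1, ?_, by simp⟩
    rw [map_add, map_pow, hw0, zero_pow (by omega), zero_add, map_one]
  have hmul : (w : LaurentSeries F) * ((w ^ (q - 1) + 1 : PowerSeries F) : LaurentSeries F) =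
      HahnSeries.single ((q : ℤ) + 1) 1 := by
    rw [← hcoe, PowerSeries.coe_add, PowerSeries.coe_pow, PowerSeries.coe_one, mul_add, mul_one,
      ← pow_succ', Nat.sub_add_cancel hq.le]
  have := (LeadAt.single (F := F) ((q : ℤ) + 1) 1).div hu one_ne_zero
  rwa [← hmul, mul_div_cancel_right₀ _ (hu.ne_zero one_ne_zero), sub_zero, div_one] at this

/-- The expansion of `1 / y` at infinity. -/
def yInv : LaurentSeries F := (exists_yInv F q).choose

theorem leadAt_yInv : LeadAt (yInv F q) (q + 1) 1 := (exists_yInv F q).choose_spec.2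

theorem yInv_ne_zero : yInv F q ≠ 0 := (leadAt_yInv F q).ne_zero one_ne_zero

/-- The expansion of `y` at infinity. -/
def ySeries : LaurentSeries F := (yInv F q)⁻¹

/-- The expansion of `x` at infinity. -/
def xSeries : LaurentSeries F := HahnSeries.single 1 1 * (yInv F q)⁻¹

theorem leadAt_ySeries : LeadAt (ySeries F q) (-(q + 1)) 1 := by
  have := (leadAt_yInv F q).inv one_ne_zero
  rwa [inv_one] at this

theorem leadAt_xSeries : LeadAt (xSeries F q) (-q) 1 := by
  have := (LeadAt.single 1 (1 : F)).mul (leadAt_ySeries F q)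
  rwa [one_mul, neg_add_rev, ← add_assoc, add_neg_cancel, zero_add] at this

theorem xSeries_pow : xSeries F q ^ (q + 1) = ySeries F q ^ q + ySeries F q := by
  have hw := yInv_ne_zero F q
  have h : HahnSeries.single (1 : ℤ) (1 : F) ^ (q + 1) = yInv F q ^ q + yInv F q := by
    rw [yInv, (exists_yInv F q).choose_spec.1, HahnSeries.single_pow]
    simp
  rw [xSeries, ySeries, mul_pow, h, add_mul, pow_succ, ← mul_assoc, ← mul_pow, mul_inv_cancel₀ hw,
    one_pow, one_mul, mul_comm _ (yInv F q)⁻¹, ← mul_assoc, mul_inv_cancel₀ hw, one_mul, add_comm]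

/-- The expansion of the elements of `F[x,y]` in the local parameter `x / y` at infinity. -/
def expandRing : CoordRing F q →+* LaurentSeries F :=
  AdjoinRoot.lift (eval₂RingHom HahnSeries.C (xSeries F q)) (ySeries F q) (by
    rw [curvePoly]
    rw [eval₂_sub, eval₂_add, eval₂_X_pow, eval₂_X, eval₂_C, coe_eval₂RingHom, eval₂_X_pow,
      xSeries_pow, sub_self])

theorem expandRing_of (p : F[X]) :
    expandRing F q (AdjoinRoot.of _ p) = p.eval₂ HahnSeries.C (xSeries F q) := by
  rw [expandRing, AdjoinRoot.lift_of]
  rfl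

theorem expandRing_x : expandRing F q x = xSeries F q := by
  rw [x, expandRing_of, eval₂_X]

theorem expandRing_y : expandRing F q y = ySeries F q := by
  rw [y, expandRing, AdjoinRoot.lift_root]

theorem expandRing_algebraMap (a : F) :
    expandRing F q (algebraMap F _ a) = HahnSeries.C a := by
  rw [algebraMap_eq_of_C, expandRing_of, eval₂_C]

end Expansion

/-! ### The order function as pole order at infinity -/

section Order

theorem eq_of_modEq_of_lt {q b b' : ℕ} (hb : b < q) (hb' : b' < q) (h : (q : ℤ) ∣ b - b') :
    b = b' := by
  have : (b' : ℤ) ≡ b [ZMOD q] := Int.modEq_iff_dvd.2 h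
  exact ((Int.natCast_modEq_iff.1 this).eq_of_lt_of_lt hb' hb).symm

theorem of_eq_sum {F : Type*} [Field F] {q : ℕ} (p : F[X]) : AdjoinRoot.of (curvePoly F q) p =
    ∑ a ∈ p.support, algebraMap F (CoordRing F q) (p.coeff a) * x ^ a := by
  conv_lhs => rw [p.as_sum_support]
  rw [map_sum]
  refine Finset.sum_congr rfl fun a _ => ?_
  rw [← C_mul_X_pow_eq_monomial, map_mul, map_pow, algebraMap_eq_of_C, x]

variable {F : Type*} [Field F] {q : ℕ} [Fact (IsPrimePow q)]

/-- The coordinate of `f` at `y^b` in the basis `1, y, …, y^(q-1)` of `F[x,y]` over `F[x]`. -/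
def yCoeff (f : CoordRing F q) (b : ℕ) : F[X] :=
  (AdjoinRoot.modByMonicHom (curvePoly_monic F q) f).coeff b

theorem natDegree_curvePoly : (curvePoly F q).natDegree = q := by
  have hq := one_lt_q q
  rw [curvePoly, add_sub_assoc, natDegree_add_eq_left_of_natDegree_lt, natDegree_X_pow]
  rw [natDegree_X_sub_C, natDegree_X_pow]
  exact hq

theorem eq_sum_yCoeff (f : CoordRing F q) :
    f = ∑ b ∈ Finset.range q, AdjoinRoot.of (curvePoly F q) (yCoeff f b) * y ^ b := by
  have hq := one_lt_q q
  set g := AdjoinRoot.modByMonicHom (curvePoly_monic F q) f with hg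
  have hdeg : g.natDegree < q := by
    obtain ⟨f', rfl⟩ := AdjoinRoot.mk_surjective f
    rw [hg, AdjoinRoot.modByMonicHom_mk]
    have := natDegree_modByMonic_lt f' (curvePoly_monic F q) (by
      intro h
      have := congrArg natDegree h
      rw [natDegree_curvePoly, natDegree_one] at this
      omega)
    rwa [natDegree_curvePoly] at this
  have h1 : AdjoinRoot.mk _ g = f := AdjoinRoot.mk_leftInverse (curvePoly_monic F q) f
  have h2 := congrArg (AdjoinRoot.mk (curvePoly F q)) (as_sum_range' g q hdeg)
  rw [h1, map_sum] at h2
  conv_lhs => rw [h2]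
  refine Finset.sum_congr rfl fun b _ => ?_
  rw [← C_mul_X_pow_eq_monomial, map_mul, map_pow, AdjoinRoot.mk_C, AdjoinRoot.mk_X]
  rfl

theorem eq_sum_monomials (f : CoordRing F q) :
    f = ∑ t ∈ (Finset.range q).sigma (xSupport f),
      algebraMap F (CoordRing F q) (coef f t.2 t.1) * x ^ t.2 * y ^ t.1 := by
  conv_lhs => rw [eq_sum_yCoeff f]
  rw [Finset.sum_sigma]
  refine Finset.sum_congr rfl fun b _ => ?_
  rw [of_eq_sum, Finset.sum_mul]
  rfl

theorem leadAt_monomial (c : F) (a b : ℕ) :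
    LeadAt (expandRing F q (algebraMap F (CoordRing F q) c * x ^ a * y ^ b))
      (-((a * q + b * (q + 1) : ℕ) : ℤ)) c := by
  rw [map_mul, map_mul, map_pow, map_pow, expandRing_algebraMap, expandRing_x, expandRing_y]
  have := ((LeadAt.const c).mul ((leadAt_xSeries F q).pow a)).mul ((leadAt_ySeries F q).pow b)
  rw [one_pow, one_pow, mul_one, mul_one] at this
  convert this using 1
  push_cast
  ring

/-- The pole order aq + b(q+1) determines b, its residue mod q, and then a. So the monomials of f
cannot cancel at infinity, and the one of largest order dominates. -/
theorem exists_rho_eq {f : CoordRing F q} (hf : f ≠ 0) :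
    ∃ (N : ℤ) (a : F), a ≠ 0 ∧ rho f = N ∧ LeadAt (expandRing F q f) (-N) a := by
  set s := (Finset.range q).sigma (xSupport f)
  have hs : s.Nonempty := by
    rw [Finset.nonempty_iff_ne_empty]
    intro h
    apply hf
    rw [eq_sum_monomials f, show (Finset.range q).sigma (xSupport f) = ∅ from h, Finset.sum_empty]
  obtain ⟨t, ht, hmin, hlead⟩ := LeadAt.exists_dominant hs
    (u := fun t => expandRing F q (algebraMap F (CoordRing F q) (coef f t.2 t.1) * x ^ t.2 * y ^ t.1))
    (fun t _ => leadAt_monomial _ _ _) (by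
      rintro ⟨b, a⟩ ht ⟨b', a'⟩ ht' h
      have hb := Finset.mem_range.1 (Finset.mem_sigma.1 ht).1
      have hb' := Finset.mem_range.1 (Finset.mem_sigma.1 ht').1
      have hq : (q : ℤ) ≠ 0 := by have := one_lt_q q; omega
      have h' := neg_injective h
      push_cast at h'
      have hbb : b = b' := eq_of_modEq_of_lt hb hb' ⟨a' - a + b' - b, by linear_combination h'⟩
      subst hbb
      have : (a : ℤ) = a' := mul_right_cancel₀ hq (by linear_combination h')
      rw [Int.natCast_inj.1 this])
  rw [← map_sum, ← eq_sum_monomials] at hlead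
  refine ⟨((t.2 * q + t.1 * (q + 1) : ℕ) : ℤ), coef f t.2 t.1, ?_, ?_, hlead⟩
  · exact mem_support_iff.1 (Finset.mem_sigma.1 ht).2
  · have hsup : rho f = s.sup fun t => (((t.2 * q + t.1 * (q + 1) : ℕ) : ℤ) : WithBot ℤ) := by
      rw [Finset.sup_sigma]
      rfl
    rw [hsup]
    refine le_antisymm (Finset.sup_le fun c hc => ?_)
      (Finset.le_sup (f := fun t : (_ : ℕ) × ℕ =>
        (((t.2 * q + t.1 * (q + 1) : ℕ) : ℤ) : WithBot ℤ)) ht)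
    exact WithBot.coe_le_coe.2 (neg_le_neg_iff.1 (hmin c hc))

theorem rho_zero : rho (0 : CoordRing F q) = ⊥ := by
  rw [rho]
  refine Finset.sup_eq_bot_iff _ _ |>.2 fun b _ => ?_
  rw [xSupport, map_zero, coeff_zero, support_zero, Finset.sup_empty]

theorem expandRing_injective : Function.Injective (expandRing F q) := by
  rw [injective_iff_map_eq_zero]
  intro f hf
  by_contra h
  obtain ⟨N, a, ha, -, hl⟩ := exists_rho_eq h
  exact hl.ne_zero ha hf

theorem rho_eq_of_leadAt {f : CoordRing F q} {N : ℤ} {a : F}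
    (h : LeadAt (expandRing F q f) (-N) a) (ha : a ≠ 0) : rho f = N := by
  have hf : f ≠ 0 := by
    rintro rfl
    exact h.ne_zero ha (map_zero _)
  obtain ⟨M, b, hb, hM, hl⟩ := exists_rho_eq hf
  rw [hM, neg_injective (h.eq_of_ne_zero ha hl hb)]

theorem rho_lt_of_leadAt {f : CoordRing F q} {N : ℤ}
    (h : LeadAt (expandRing F q f) (-N) 0) : rho f < N := by
  rcases eq_or_ne f 0 with rfl | hf
  · rw [rho_zero]
    exact WithBot.bot_lt_coe N
  obtain ⟨M, b, hb, hM, hl⟩ := exists_rho_eq hf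
  rw [hM, WithBot.coe_lt_coe]
  by_contra! hNM
  rcases hNM.eq_or_lt with rfl | hNM
  · exact hb (hl.unique h)
  · exact hb (hl.unique (h.of_lt (by omega)))

variable (F q) in
/-- The expansion of the elements of `F(x,y)` at infinity. -/
def expand : FunField F q →+* LaurentSeries F :=
  IsFractionRing.lift (expandRing_injective (F := F) (q := q))

theorem expand_algebraMap (f : CoordRing F q) :
    expand F q (algebraMap _ _ f) = expandRing F q f :=
  IsFractionRing.lift_algebraMap _ _

/-- Leading terms multiply, so the fraction chosen to represent h does not matter. -/
theorem rhoFrac_eq_of_leadAt {h : FunField F q} {N : ℤ} {a : F}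
    (hl : LeadAt (expand F q h) (-N) a) (ha : a ≠ 0) : rhoFrac h = N := by
  rw [rhoFrac]
  set s := IsLocalization.sec (nonZeroDivisors (CoordRing F q)) h
  have hs : h * algebraMap _ _ (s.2 : CoordRing F q) = algebraMap _ _ s.1 :=
    IsLocalization.sec_spec _ h
  obtain ⟨M, b, hb, hM, hb'⟩ := exists_rho_eq (nonZeroDivisors.ne_zero s.2.2)
  have h1 := hl.mul hb'
  rw [← expand_algebraMap, ← map_mul, hs, expand_algebraMap, ← neg_add] at h1
  rw [rho_eq_of_leadAt h1 (mul_ne_zero ha hb), ord, hM, WithBot.unbotD_coe, ← WithBot.coe_add]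
  congr 1
  ring

theorem rhoFrac_zero : rhoFrac (0 : FunField F q) = ⊥ := by
  rw [rhoFrac]
  set s := IsLocalization.sec (nonZeroDivisors (CoordRing F q)) (0 : FunField F q)
  have hs : (0 : FunField F q) * algebraMap _ _ (s.2 : CoordRing F q) = algebraMap _ _ s.1 :=
    IsLocalization.sec_spec _ _
  rw [zero_mul] at hs
  rw [(IsFractionRing.injective (CoordRing F q) (FunField F q)) (hs.symm.trans (map_zero _).symm),
    rho_zero, WithBot.bot_add]

theorem exists_leadAt_of_ne_zero {h : LaurentSeries F} (hh : h ≠ 0) :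
    ∃ (n : ℤ) (a : F), a ≠ 0 ∧ LeadAt h n a :=
  ⟨h.order, h.coeff h.order, HahnSeries.coeff_order_eq_zero.not.2 hh, rfl,
    fun _ hk => HahnSeries.coeff_eq_zero_of_lt_order hk⟩

theorem rhoFrac_le_of_leadAt {h : FunField F q} {N : ℤ} {a : F}
    (hl : LeadAt (expand F q h) (-N) a) : rhoFrac h ≤ N := by
  rcases eq_or_ne h 0 with rfl | hh
  · rw [rhoFrac_zero]
    exact bot_le
  obtain ⟨n, b, hb, hlb⟩ := exists_leadAt_of_ne_zero
    ((map_ne_zero_iff _ (expand F q).injective).2 hh)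
  rw [rhoFrac_eq_of_leadAt (N := -n) (by rwa [neg_neg]) hb, WithBot.coe_le_coe]
  by_contra! hn
  exact hb (hlb.unique (hl.of_lt (by omega)))

end Order

/-! ### Rational functions in `x` -/

section RatFunc

variable {F : Type*} [Field F] {q : ℕ} [Fact (IsPrimePow q)]

/-- A series with a pole is transcendental over F. This serves both for expansions in 1/x and for
the expansion of x in t. -/
theorem eval₂RingHom_injective_of_leadAt {ξ : LaurentSeries F} {k : ℤ} (hξ : LeadAt ξ (-k) 1)
    (hk : 0 < k) : Function.Injective (eval₂RingHom (HahnSeries.C : F →+* LaurentSeries F) ξ) := by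
  rw [injective_iff_map_eq_zero]
  intro p hp
  by_contra h
  exact (hξ.eval₂ hk p).ne_zero (leadingCoeff_ne_zero.2 h) hp

variable (F) in
/-- The expansion of rational functions in `x` as Laurent series in `1 / x`. -/
def laurentHom : RatFunc F →+* LaurentSeries F :=
  RatFunc.liftRingHom (eval₂RingHom HahnSeries.C (HahnSeries.single (-1 : ℤ) (1 : F)))
    (nonZeroDivisors_le_comap_nonZeroDivisors_of_injective _
      (eval₂RingHom_injective_of_leadAt (LeadAt.single _ _) one_pos))

theorem laurentHom_apply (c : RatFunc F) :
    laurentHom F c = c.eval HahnSeries.C (HahnSeries.single (-1 : ℤ) (1 : F)) := by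
  conv_lhs => rw [← RatFunc.num_div_denom c]
  rw [laurentHom, RatFunc.liftRingHom_apply_div]
  rfl

theorem laurentCoeff_eq (c : RatFunc F) (a : ℤ) :
    laurentCoeff c a = (laurentHom F c).coeff (-a) := by
  rw [laurentHom_apply, laurentCoeff]

theorem expand_eval₂ (p : F[X]) :
    expand F q (p.eval₂ (algebraMap F (FunField F q)) (algebraMap (CoordRing F q) _ x)) =
      p.eval₂ HahnSeries.C (xSeries F q) := by
  rw [hom_eval₂, expand_algebraMap, expandRing_x]
  congr 1
  ext1 a
  rw [RingHom.comp_apply, IsScalarTower.algebraMap_apply F (CoordRing F q) (FunField F q),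
    expand_algebraMap, expandRing_algebraMap]

theorem q_pos_int (q : ℕ) [Fact (IsPrimePow q)] : (0 : ℤ) < q := by
  have := one_lt_q q
  omega

variable (F q) in
/-- The embedding of `F(x)` into `F(x,y)` as a ring homomorphism. -/
def ofRatFuncHom : RatFunc F →+* FunField F q :=
  RatFunc.liftRingHom (eval₂RingHom (algebraMap F (FunField F q)) (algebraMap (CoordRing F q) _ x))
    (nonZeroDivisors_le_comap_nonZeroDivisors_of_injective _ (by
      rw [injective_iff_map_eq_zero]
      intro p hp
      refine (injective_iff_map_eq_zero _).1
        (eval₂RingHom_injective_of_leadAt (leadAt_xSeries F q) (q_pos_int q)) p ?_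
      rw [coe_eval₂RingHom] at hp ⊢
      rw [← expand_eval₂, hp, map_zero]))

theorem ofRatFuncHom_apply (c : RatFunc F) : ofRatFuncHom F q c = ofRatFunc c := by
  conv_lhs => rw [← RatFunc.num_div_denom c]
  rw [ofRatFuncHom, RatFunc.liftRingHom_apply_div]
  rfl

/-- The leading terms of a rational function in `1 / x` and in the local parameter at infinity. -/
theorem exists_leadAt_ratFunc {c : RatFunc F} (hc : c ≠ 0) :
    ∃ (n : ℤ) (a : F), a ≠ 0 ∧ LeadAt (laurentHom F c) (-n) a ∧
      LeadAt (expand F q (ofRatFuncHom F q c)) (-(n * q)) a := by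
  have hn : c.num.leadingCoeff ≠ 0 := leadingCoeff_ne_zero.2 (RatFunc.num_ne_zero hc)
  have hd : c.denom.leadingCoeff ≠ 0 := leadingCoeff_ne_zero.2 c.denom_ne_zero
  refine ⟨(c.num.natDegree : ℤ) - c.denom.natDegree, c.num.leadingCoeff / c.denom.leadingCoeff,
    div_ne_zero hn hd, ?_, ?_⟩
  · rw [laurentHom_apply, RatFunc.eval]
    have hξ : LeadAt (HahnSeries.single (-1 : ℤ) (1 : F)) (-1) 1 := LeadAt.single _ _
    convert (hξ.eval₂ one_pos c.num).div (hξ.eval₂ one_pos c.denom) hd using 1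
    ring
  · rw [ofRatFuncHom_apply, ofRatFunc, RatFunc.eval, map_div₀, expand_eval₂, expand_eval₂]
    have hξ := leadAt_xSeries F q
    convert (hξ.eval₂ (q_pos_int q) c.num).div (hξ.eval₂ (q_pos_int q) c.denom) hd using 1
    ring

end RatFunc

/-! ### Coefficients of rational functions expanded in 1/x -/

section LaurentCoeff

variable {F : Type*} [Field F]

theorem coeff_C_mul_laurent (r : F) (h : LaurentSeries F) (n : ℤ) :
    (HahnSeries.C r * h).coeff n = r * h.coeff n := by
  rw [HahnSeries.C_apply, HahnSeries.coeff_single_mul, sub_zero]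

theorem laurentHom_C (a : F) : laurentHom F (RatFunc.C a) = HahnSeries.C a := by
  rw [laurentHom_apply, RatFunc.eval_C]

theorem laurentHom_X : laurentHom F RatFunc.X = HahnSeries.single (-1 : ℤ) (1 : F) := by
  rw [laurentHom_apply, RatFunc.eval_X]

@[simp]
theorem laurentCoeff_zero (a : ℤ) : laurentCoeff (0 : RatFunc F) a = 0 := by
  rw [laurentCoeff_eq, map_zero, HahnSeries.coeff_zero]

theorem laurentCoeff_add (c c' : RatFunc F) (a : ℤ) :
    laurentCoeff (c + c') a = laurentCoeff c a + laurentCoeff c' a := by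
  simp only [laurentCoeff_eq, map_add, HahnSeries.coeff_add]

theorem laurentCoeff_sub (c c' : RatFunc F) (a : ℤ) :
    laurentCoeff (c - c') a = laurentCoeff c a - laurentCoeff c' a := by
  simp only [laurentCoeff_eq, map_sub, HahnSeries.coeff_sub]

theorem laurentCoeff_sum {ι : Type*} (s : Finset ι) (c : ι → RatFunc F) (a : ℤ) :
    laurentCoeff (∑ i ∈ s, c i) a = ∑ i ∈ s, laurentCoeff (c i) a := by
  simp only [laurentCoeff_eq, map_sum, HahnSeries.coeff_sum]

theorem laurentCoeff_C_mul (r : F) (c : RatFunc F) (a : ℤ) :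
    laurentCoeff (RatFunc.C r * c) a = r * laurentCoeff c a := by
  rw [laurentCoeff_eq, laurentCoeff_eq, map_mul, laurentHom_C, coeff_C_mul_laurent]

theorem laurentCoeff_X_pow_mul (k : ℕ) (c : RatFunc F) (a : ℤ) :
    laurentCoeff (RatFunc.X ^ k * c) a = laurentCoeff c (a - k) := by
  rw [laurentCoeff_eq, laurentCoeff_eq, map_mul, map_pow, laurentHom_X, HahnSeries.single_pow,
    HahnSeries.coeff_single_mul, one_pow, one_mul]
  congr 1
  rw [nsmul_eq_mul]
  ring

theorem algebraMap_eq_sum (p : F[X]) :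
    algebraMap F[X] (RatFunc F) p = ∑ a ∈ p.support, RatFunc.C (p.coeff a) * RatFunc.X ^ a := by
  conv_lhs => rw [p.as_sum_support]
  rw [map_sum]
  exact Finset.sum_congr rfl fun a _ => RatFunc.algebraMap_monomial _ _

theorem laurentCoeff_algebraMap_mul (p : F[X]) (c : RatFunc F) (n : ℤ) :
    laurentCoeff (algebraMap F[X] (RatFunc F) p * c) n =
      ∑ a ∈ p.support, p.coeff a * laurentCoeff c (n - a) := by
  rw [algebraMap_eq_sum, Finset.sum_mul, laurentCoeff_sum]
  refine Finset.sum_congr rfl fun a _ => ?_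
  rw [mul_assoc, laurentCoeff_C_mul, laurentCoeff_X_pow_mul]

theorem laurentCoeff_one (a : ℤ) : laurentCoeff (1 : RatFunc F) a = if a = 0 then 1 else 0 := by
  rw [laurentCoeff_eq, map_one, HahnSeries.coeff_one]
  simp only [neg_eq_zero]

theorem laurentCoeff_algebraMap_of_neg (p : F[X]) {n : ℤ} (hn : n < 0) :
    laurentCoeff (algebraMap F[X] (RatFunc F) p) n = 0 := by
  rw [← mul_one (algebraMap F[X] (RatFunc F) p), laurentCoeff_algebraMap_mul]
  refine Finset.sum_eq_zero fun a _ => ?_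
  rw [laurentCoeff_one, if_neg (by omega), mul_zero]

/-- The geometric series `1 / (x - α) = ∑ α^k x^(-k-1)`. -/
theorem laurentCoeff_inv_X_sub_C (α : F) (k : ℤ) :
    laurentCoeff (RatFunc.X - RatFunc.C α)⁻¹ (-1 - k) = if 0 ≤ k then α ^ k.toNat else 0 := by
  let G : LaurentSeries F := HahnSeries.single 1 1 *
    ((PowerSeries.mk fun n => α ^ n : PowerSeries F) : LaurentSeries F)
  have hG (n : ℤ) : G.coeff n = if 1 ≤ n then α ^ (n - 1).toNat else 0 := by
    rw [HahnSeries.coeff_single_mul, one_mul, PowerSeries.coeff_coe, PowerSeries.coeff_mk]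
    by_cases h : 1 ≤ n
    · rw [if_pos h, if_neg (by omega)]
      congr 1
      omega
    · rw [if_neg h, if_pos (by omega)]
  have hmul : (HahnSeries.single (-1 : ℤ) (1 : F) - HahnSeries.C α) * G = 1 := by
    ext n
    rw [sub_mul, HahnSeries.coeff_sub, HahnSeries.coeff_single_mul, coeff_C_mul_laurent, one_mul,
      HahnSeries.coeff_one, hG, hG]
    rcases lt_trichotomy n 0 with h | rfl | h
    · rw [if_neg (by omega), if_neg (by omega), if_neg (by omega)]
      simp
    · simp
    · rw [if_pos (by omega), if_pos (by omega), if_neg (by omega), ← pow_succ',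
        show (n - -1 - 1).toNat = (n - 1).toNat + 1 by omega, sub_self]
  rw [laurentCoeff_eq, map_inv₀, map_sub, laurentHom_X, laurentHom_C,
    inv_eq_of_mul_eq_one_right hmul, hG]
  by_cases h : 0 ≤ k
  · rw [if_pos h, if_pos (by omega)]
    congr 1
    omega
  · rw [if_neg h, if_neg (by omega)]

end LaurentCoeff

section Curve

variable {F : Type*} [Field F] {q : ℕ}

theorem algebraMap_funField (a : F) : algebraMap F (FunField F q) a =
    algebraMap (CoordRing F q) (FunField F q) (algebraMap F (CoordRing F q) a) :=
  IsScalarTower.algebraMap_apply _ _ _ _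

theorem termOrder_injective {a a' : ℤ} {b b' : Fin q} (h : termOrder a b = termOrder a' b') :
    a = a' ∧ b = b' := by
  have hq : (q : ℤ) ≠ 0 := by have := b.pos; omega
  rw [termOrder, termOrder] at h
  have hb : (b : ℕ) = b' := eq_of_modEq_of_lt b.2 b'.2 ⟨a - a' + b' - b, by linear_combination -h⟩
  refine ⟨?_, Fin.ext hb⟩
  rw [hb] at h
  exact mul_right_cancel₀ hq (by linear_combination h)

theorem x_pow_succ_eq : (x : CoordRing F q) ^ (q + 1) = y ^ q + y := by
  have h := AdjoinRoot.mk_self (f := curvePoly F q)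
  conv_lhs at h => arg 2; rw [curvePoly]
  rw [map_sub, map_add, map_pow, sub_eq_zero] at h
  rw [x, ← map_pow]
  exact h.symm

end Curve

/-! ### Expansions in the ∗-basis -/

section Star

variable {F : Type*} [Field F] {q : ℕ} [Fact (IsPrimePow q)]

theorem isStarExpansion_iff {h : FunField F q} {c : Fin q → RatFunc F} :
    IsStarExpansion h c ↔
      h = ∑ b, ofRatFuncHom F q (c b) * algebraMap (CoordRing F q) _ (zstar b) := by
  simp only [IsStarExpansion, ofRatFuncHom_apply]

theorem IsStarExpansion.add {h h' : FunField F q} {c c' : Fin q → RatFunc F}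
    (hc : IsStarExpansion h c) (hc' : IsStarExpansion h' c') :
    IsStarExpansion (h + h') (c + c') := by
  rw [isStarExpansion_iff] at *
  rw [hc, hc', ← Finset.sum_add_distrib]
  exact Finset.sum_congr rfl fun b _ => by rw [Pi.add_apply, map_add, add_mul]

theorem IsStarExpansion.mul {h : FunField F q} {c : Fin q → RatFunc F}
    (hc : IsStarExpansion h c) (u : RatFunc F) :
    IsStarExpansion (ofRatFuncHom F q u * h) (fun b => u * c b) := by
  rw [isStarExpansion_iff] at *
  rw [hc, Finset.mul_sum]
  exact Finset.sum_congr rfl fun b _ => by rw [map_mul, mul_assoc]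

theorem isStarExpansion_zero : IsStarExpansion (0 : FunField F q) 0 := by
  rw [isStarExpansion_iff]
  simp

theorem isStarExpansion_zstar (b : Fin q) :
    IsStarExpansion (algebraMap (CoordRing F q) (FunField F q) (zstar b)) (Pi.single b 1) := by
  rw [isStarExpansion_iff, Finset.sum_eq_single b]
  · simp
  · intro c _ hc
    rw [Pi.single_eq_of_ne hc, map_zero, zero_mul]
  · simp

theorem ofRatFuncHom_C (a : F) :
    ofRatFuncHom F q (RatFunc.C a) = algebraMap F (FunField F q) a := by
  rw [ofRatFuncHom_apply, ofRatFunc, RatFunc.eval_C]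

theorem ofRatFuncHom_X :
    ofRatFuncHom F q RatFunc.X = algebraMap (CoordRing F q) (FunField F q) x := by
  rw [ofRatFuncHom_apply, ofRatFunc, RatFunc.eval_X]

theorem algebraMap_of (p : F[X]) :
    algebraMap (CoordRing F q) (FunField F q) (AdjoinRoot.of _ p) =
      ofRatFuncHom F q (algebraMap F[X] (RatFunc F) p) := by
  rw [of_eq_sum, algebraMap_eq_sum, map_sum, map_sum]
  refine Finset.sum_congr rfl fun a _ => ?_
  rw [map_mul, map_mul, map_pow, map_pow, ofRatFuncHom_C, ofRatFuncHom_X, algebraMap_funField]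

/-! ### The orders of the terms of the `∗`-expansion -/

theorem exists_termOrder_eq (N : ℤ) : ∃ (a : ℤ) (b : Fin q), termOrder a b = N := by
  have hq := q_pos_int q
  have h0 := Int.emod_nonneg (-1 - N) hq.ne'
  have h1 := Int.emod_lt_of_pos (-1 - N) hq
  have h2 := Int.emod_add_mul_ediv (-1 - N) q
  -- The order of x^a z∗_b is congruent to -1 - b mod q, which forces b to be the residue of -1 - N.
  refine ⟨-((-1 - N) / q) - q + (-1 - N) % q, ⟨((-1 - N) % q).toNat, by omega⟩, ?_⟩
  rw [termOrder]
  simp only [Int.toNat_of_nonneg h0]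
  linear_combination -h2

theorem leadAt_y_pow (b : ℕ) : LeadAt (expandRing F q (y ^ b)) (-(b * (q + 1) : ℤ)) 1 := by
  simpa using leadAt_monomial (F := F) (q := q) 1 0 b

theorem leadAt_x_pow (a : ℕ) : LeadAt (expandRing F q (x ^ a)) (-(a * q : ℤ)) 1 := by
  simpa using leadAt_monomial (F := F) (q := q) 1 a 0

theorem leadAt_zstar (b : Fin q) :
    LeadAt (expandRing F q (zstar b)) (-((q : ℤ) ^ 2 - 1 - (b : ℕ) * (q + 1))) 1 := by
  have hq := one_lt_q q
  have hb := b.2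
  have he : ((q : ℤ) ^ 2 - 1 - (b : ℕ) * (q + 1)) = ((q - 1 - b : ℕ) : ℤ) * (q + 1) := by
    rw [Nat.sub_sub, Nat.cast_sub (by omega)]
    push_cast
    ring
  rw [he, zstar]
  split_ifs with h0
  · rw [h0, Nat.sub_zero, map_add, map_one]
    have hlt : (0 : ℤ) < ((q - 1 : ℕ) : ℤ) * (q + 1) := by
      have : (0 : ℤ) < ((q - 1 : ℕ) : ℤ) := by omega
      positivity
    have := (leadAt_y_pow (F := F) (q := q) (q - 1)).add
      ((LeadAt.one (F := F)).of_lt (neg_neg_of_pos hlt))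
    rwa [add_zero] at this
  · exact leadAt_y_pow _

/-- The leading term of `h` at infinity is the leading term of its `∗`-expansion. -/
theorem IsStarExpansion.laurentCoeff_of_leadAt {h : FunField F q} {c : Fin q → RatFunc F}
    (hc : IsStarExpansion h c) {N : ℤ} {α : F} (hl : LeadAt (expand F q h) (-N) α) (a : ℤ)
    (b : Fin q) : (N < termOrder a b → laurentCoeff (c b) a = 0) ∧
      (termOrder a b = N → laurentCoeff (c b) a = α) := by
  classical
  have hlead (b : Fin q) : ∃ (n : ℤ) (a : F), c b ≠ 0 → a ≠ 0 ∧ LeadAt (laurentHom F (c b)) (-n) a ∧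
      LeadAt (expand F q (ofRatFuncHom F q (c b) * algebraMap (CoordRing F q) _ (zstar b)))
        (-termOrder n b) a := by
    by_cases hb : c b = 0
    · exact ⟨0, 0, fun h => absurd hb h⟩
    obtain ⟨n, a, ha, h1, h2⟩ := exists_leadAt_ratFunc (q := q) hb
    refine ⟨n, a, fun _ => ⟨ha, h1, ?_⟩⟩
    have := h2.mul (leadAt_zstar b)
    rwa [mul_one, ← expand_algebraMap, ← map_mul, ← neg_add] at this
  choose n lc hlc using hlead
  let s := Finset.univ.filter fun b => c b ≠ 0
  have hsum : h = ∑ b ∈ s, ofRatFuncHom F q (c b) * algebraMap (CoordRing F q) _ (zstar b) := by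
    rw [isStarExpansion_iff.1 hc, Finset.sum_filter]
    refine Finset.sum_congr rfl fun b _ => ?_
    split_ifs with hb
    · rfl
    · rw [not_not.1 hb, map_zero, zero_mul]
  rcases s.eq_empty_or_nonempty with hs | hs
  · have hz (b : Fin q) : c b = 0 := by
      by_contra hb
      have : b ∈ s := Finset.mem_filter.2 ⟨Finset.mem_univ _, hb⟩
      rw [hs] at this
      exact absurd this (Finset.notMem_empty _)
    rw [hs, Finset.sum_empty] at hsum
    rw [hsum, map_zero] at hl
    rw [hz, laurentCoeff_zero]
    exact ⟨fun _ => rfl, fun _ => (LeadAt.zero _).unique hl⟩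
  -- The nonzero summands have pairwise distinct orders, so one of them carries the leading term of
  -- h.
  obtain ⟨b₀, hb₀, hmin, hdom⟩ := LeadAt.exists_dominant hs
    (fun b hb => (hlc b (Finset.mem_filter.1 hb).2).2.2)
    (fun b _ b' _ hbb => (termOrder_injective (neg_injective hbb)).2)
  rw [← map_sum, ← hsum] at hdom
  have hne : lc b₀ ≠ 0 := (hlc b₀ (Finset.mem_filter.1 hb₀).2).1
  have hN : termOrder (n b₀) b₀ ≤ N := by
    by_contra! hN
    exact hne (hdom.unique (hl.of_lt (neg_lt_neg hN)))
  have hqpos := q_pos_int q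
  by_cases hb : c b = 0
  · rw [hb, laurentCoeff_zero]
    refine ⟨fun _ => rfl, fun hN' => ?_⟩
    rcases hN.eq_or_lt with hN | hN
    · rw [← hN] at hN'
      rw [(termOrder_injective hN').2] at hb
      exact absurd hb (Finset.mem_filter.1 hb₀).2
    · exact (hdom.of_lt (neg_lt_neg hN)).unique hl
  have hbs : b ∈ s := Finset.mem_filter.2 ⟨Finset.mem_univ _, hb⟩
  have hle : termOrder (n b) b ≤ termOrder (n b₀) b₀ := neg_le_neg_iff.1 (hmin b hbs)
  have hvanish (a : ℤ) (h : termOrder (n b) b < termOrder a b) : laurentCoeff (c b) a = 0 := by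
    rw [laurentCoeff_eq]
    refine (hlc b hb).2.1.2 _ (neg_lt_neg ?_)
    rw [termOrder, termOrder] at h
    exact lt_of_mul_lt_mul_right (lt_of_add_lt_add_right h) hqpos.le
  refine ⟨fun h => hvanish a ((hle.trans hN).trans_lt h), fun h => ?_⟩
  rcases hN.eq_or_lt with hN | hN
  · obtain ⟨rfl, rfl⟩ := termOrder_injective (h.trans hN.symm)
    rw [laurentCoeff_eq, (hlc _ hb).2.1.1]
    rw [hN] at hdom
    exact hdom.unique hl
  · rw [hvanish a (by omega)]
    exact (hdom.of_lt (neg_lt_neg hN)).unique hl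

theorem IsStarExpansion.isStarMonic {h : FunField F q} {c : Fin q → RatFunc F}
    (hc : IsStarExpansion h c) {N : ℤ} (hl : LeadAt (expand F q h) (-N) 1) : IsStarMonic h := by
  obtain ⟨a, b, hab⟩ := exists_termOrder_eq (q := q) N
  refine ⟨c, hc, a, b, (hc.laurentCoeff_of_leadAt hl a b).2 hab, fun a' b' h' => ?_⟩
  rw [hab]
  by_contra! hlt
  exact h' ((hc.laurentCoeff_of_leadAt hl a' b').1 hlt)

/-! ### Closure properties of `StarTermsAtLeast` -/

namespace StarTermsAtLeast

variable {φ φ' : CoordRing F q} {N N' : ℤ}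

theorem mono (h : StarTermsAtLeast φ N) (hN : N' ≤ N) : StarTermsAtLeast φ N' :=
  let ⟨c, hc, hN'⟩ := h
  ⟨c, hc, fun a b hab => hN.trans (hN' a b hab)⟩

theorem zero (N : ℤ) : StarTermsAtLeast (0 : CoordRing F q) N :=
  ⟨0, by rw [map_zero]; exact isStarExpansion_zero, fun a b h =>
    absurd (laurentCoeff_zero a) h⟩

theorem add (h : StarTermsAtLeast φ N) (h' : StarTermsAtLeast φ' N) :
    StarTermsAtLeast (φ + φ') N := by
  obtain ⟨c, hc, hN⟩ := h
  obtain ⟨c', hc', hN'⟩ := h'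
  refine ⟨c + c', by rw [map_add]; exact hc.add hc', fun a b hab => ?_⟩
  rw [Pi.add_apply, laurentCoeff_add] at hab
  by_cases h0 : laurentCoeff (c b) a = 0
  · exact hN' a b fun h1 => hab (by rw [h0, h1, add_zero])
  · exact hN a b h0

theorem smul (h : StarTermsAtLeast φ N) (r : F) :
    StarTermsAtLeast (algebraMap F (CoordRing F q) r * φ) N := by
  obtain ⟨c, hc, hN⟩ := h
  refine ⟨fun b => RatFunc.C r * c b, ?_, fun a b hab => hN a b fun h0 => hab ?_⟩
  · rw [map_mul, ← algebraMap_funField, ← ofRatFuncHom_C]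
    exact hc.mul _
  · rw [laurentCoeff_C_mul, h0, mul_zero]

theorem neg (h : StarTermsAtLeast φ N) : StarTermsAtLeast (-φ) N := by
  simpa using h.smul (-1)

theorem x_pow_mul (h : StarTermsAtLeast φ N) (k : ℕ) :
    StarTermsAtLeast (x ^ k * φ) (k * q + N) := by
  obtain ⟨c, hc, hN⟩ := h
  refine ⟨fun b => RatFunc.X ^ k * c b, ?_, fun a b hab => ?_⟩
  · rw [map_mul, map_pow, ← ofRatFuncHom_X, ← map_pow]
    exact hc.mul _
  · rw [laurentCoeff_X_pow_mul] at hab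
    have := hN _ b hab
    rw [termOrder] at this ⊢
    linarith

theorem zstar (b : Fin q) :
    StarTermsAtLeast (zstar b : CoordRing F q) ((q : ℤ) ^ 2 - 1 - (b : ℕ) * (q + 1)) := by
  refine ⟨Pi.single b 1, isStarExpansion_zstar b, fun a c hac => ?_⟩
  by_cases hcb : c = b
  · subst hcb
    rw [Pi.single_eq_same, laurentCoeff_one] at hac
    have ha : a = 0 := by by_contra h; exact hac (if_neg h)
    rw [termOrder, ha, zero_mul, zero_add]
  · rw [Pi.single_eq_of_ne hcb, laurentCoeff_zero] at hac
    exact absurd rfl hac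

end StarTermsAtLeast

/-! ### The coordinate at `z∗_0` -/

variable (q) in
/-- The index `0`. -/
def zeroIdx : Fin q := ⟨0, (one_lt_q q).le⟩

/-- `h` has a `∗`-expansion with coordinate `u` at `z∗_0`. -/
def HasZeroCoord (h : FunField F q) (u : RatFunc F) : Prop :=
  ∃ c : Fin q → RatFunc F, IsStarExpansion h c ∧ c (zeroIdx q) = u

namespace HasZeroCoord

variable {h h' : FunField F q} {u u' : RatFunc F}

theorem zero : HasZeroCoord (0 : FunField F q) 0 := ⟨0, isStarExpansion_zero, rfl⟩

theorem add (hu : HasZeroCoord h u) (hu' : HasZeroCoord h' u') :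
    HasZeroCoord (h + h') (u + u') := by
  obtain ⟨c, hc, rfl⟩ := hu
  obtain ⟨c', hc', rfl⟩ := hu'
  exact ⟨c + c', hc.add hc', rfl⟩

theorem mul (hu : HasZeroCoord h u) (v : RatFunc F) :
    HasZeroCoord (ofRatFuncHom F q v * h) (v * u) := by
  obtain ⟨c, hc, rfl⟩ := hu
  exact ⟨_, hc.mul v, rfl⟩

theorem neg (hu : HasZeroCoord h u) : HasZeroCoord (-h) (-u) := by
  simpa using hu.mul (-1)

theorem sub (hu : HasZeroCoord h u) (hu' : HasZeroCoord h' u') :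
    HasZeroCoord (h - h') (u - u') := by
  rw [sub_eq_add_neg, sub_eq_add_neg]
  exact hu.add hu'.neg

theorem sum {ι : Type*} (s : Finset ι) {h : ι → FunField F q} {u : ι → RatFunc F}
    (hu : ∀ i ∈ s, HasZeroCoord (h i) (u i)) : HasZeroCoord (∑ i ∈ s, h i) (∑ i ∈ s, u i) := by
  classical
  induction s using Finset.induction_on with
  | empty => simpa using zero
  | insert i s hi ih =>
    rw [Finset.sum_insert hi, Finset.sum_insert hi]
    exact (hu i (Finset.mem_insert_self _ _)).add
      (ih fun j hj => hu j (Finset.mem_insert_of_mem hj))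

theorem zstar (b : Fin q) :
    HasZeroCoord (algebraMap (CoordRing F q) (FunField F q) (zstar b))
      (if (b : ℕ) = 0 then 1 else 0) := by
  refine ⟨_, isStarExpansion_zstar b, ?_⟩
  split_ifs with h
  · rw [show b = zeroIdx q from Fin.ext h, Pi.single_eq_same]
  · rw [Pi.single_eq_of_ne]
    intro h'
    rw [← h'] at h
    exact h rfl

theorem y_pow_of_lt {k : ℕ} (hk : k < q - 1) :
    HasZeroCoord (algebraMap (CoordRing F q) (FunField F q) (y ^ k)) 0 := by
  have := zstar (F := F) (⟨q - 1 - k, by omega⟩ : Fin q)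
  rwa [if_neg (by simp only; omega), Hermitian.zstar, if_neg (by simp only; omega),
    show q - 1 - (q - 1 - k) = k by omega] at this

/-- Here y^(q-1) = z∗_0 - 1, and 1 = z∗_(q-1) has coordinate 0 at z∗_0. -/
theorem y_pow_pred : HasZeroCoord (algebraMap (CoordRing F q) (FunField F q) (y ^ (q - 1))) 1 := by
  have hq := one_lt_q q
  have h0 := zstar (F := F) (zeroIdx q)
  have h1 := y_pow_of_lt (F := F) (q := q) (k := 0) (by omega)
  rw [if_pos (show ((zeroIdx q : Fin q) : ℕ) = 0 from rfl), Hermitian.zstar,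
    if_pos (show ((zeroIdx q : Fin q) : ℕ) = 0 from rfl)] at h0
  have := h0.sub h1
  rwa [← map_sub, pow_zero, add_sub_cancel_right, sub_zero] at this

end HasZeroCoord

theorem hasZeroCoord_x_pow_mul {f : CoordRing F q} {u : RatFunc F}
    (hf : HasZeroCoord (algebraMap (CoordRing F q) (FunField F q) f) u) (k : ℕ) :
    HasZeroCoord (algebraMap (CoordRing F q) (FunField F q) (x ^ k * f)) (RatFunc.X ^ k * u) := by
  rw [map_mul, map_pow, ← ofRatFuncHom_X, ← map_pow]
  exact hf.mul _

/-- The `∗`-basis is dual to `1, y, …, y^(q-1)` for the coordinate at `z∗_0`. -/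
theorem hasZeroCoord_y_pow_mul_zstar {b : ℕ} (hb : b < q) (c : Fin q) :
    HasZeroCoord (algebraMap (CoordRing F q) (FunField F q) (y ^ b * zstar c))
      (if b = c then 1 else 0) := by
  have hq := one_lt_q q
  have hcq := c.2
  by_cases hc : (c : ℕ) = 0
  · rcases b with _ | b
    · rw [if_pos hc.symm, pow_zero, one_mul]
      have := HasZeroCoord.zstar (F := F) c
      rwa [if_pos hc] at this
    · rw [if_neg (by omega), zstar, if_pos hc]
      -- The summand 1 in z∗_0 makes y z∗_0 = y^q + y = x^(q+1), a polynomial in x. The remaining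
      -- power y^b has b < q - 1, so its coordinate at z∗_0 is 0.
      have he : (y : CoordRing F q) ^ (b + 1) * (y ^ (q - 1) + 1) = x ^ (q + 1) * y ^ b := by
        obtain ⟨n, rfl⟩ : ∃ n, q = n + 1 := ⟨q - 1, by omega⟩
        rw [x_pow_succ_eq, Nat.add_sub_cancel]
        ring
      rw [he]
      simpa using hasZeroCoord_x_pow_mul (HasZeroCoord.y_pow_of_lt (F := F) (q := q) (k := b)
        (by omega)) (q + 1)
  rw [zstar, if_neg hc, ← pow_add]
  rcases lt_trichotomy b c with h | h | h
  · rw [if_neg h.ne]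
    exact HasZeroCoord.y_pow_of_lt (by omega)
  · rw [if_pos h, show b + (q - 1 - c) = q - 1 by omega]
    exact HasZeroCoord.y_pow_pred
  · rw [if_neg h.ne']
    obtain ⟨k, rfl⟩ := Nat.exists_eq_add_of_lt h
    -- The exponent is q + k, and y^q = x^(q+1) - y. Both remaining powers of y are below q - 1
    -- because c > 0.
    have he : (y : CoordRing F q) ^ (c + k + 1 + (q - 1 - c)) = x ^ (q + 1) * y ^ k - y ^ (k + 1) := by
      rw [x_pow_succ_eq, show (c : ℕ) + k + 1 + (q - 1 - c) = q + k by omega]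
      ring
    rw [he, map_sub]
    simpa using (hasZeroCoord_x_pow_mul (HasZeroCoord.y_pow_of_lt (F := F) (q := q) (k := k)
        (by omega)) (q + 1)).sub
      (HasZeroCoord.y_pow_of_lt (F := F) (q := q) (k := k + 1) (by omega))

/-- By duality, multiplication by y^b moves the coordinate at z∗_b to z∗_0. -/
theorem IsStarExpansion.hasZeroCoord_y_pow_mul {h : FunField F q} {c : Fin q → RatFunc F}
    (hc : IsStarExpansion h c) (b : Fin q) :
    HasZeroCoord (algebraMap (CoordRing F q) (FunField F q) (y ^ (b : ℕ)) * h) (c b) := by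
  have hs := HasZeroCoord.sum Finset.univ fun (b' : Fin q) _ =>
    (hasZeroCoord_y_pow_mul_zstar (F := F) b.2 b').mul (c b')
  convert hs using 1
  · rw [isStarExpansion_iff.1 hc, Finset.mul_sum]
    refine Finset.sum_congr rfl fun b' _ => ?_
    rw [map_mul]
    ring
  · rw [Finset.sum_eq_single b]
    · rw [if_pos rfl, mul_one]
    · intro b' _ hb'
      rw [if_neg fun h => hb' (Fin.ext h.symm), mul_zero]
    · simp

theorem IsStarExpansion.hasZeroCoord_mul {h : FunField F q} {c : Fin q → RatFunc F}
    (hc : IsStarExpansion h c) (f : CoordRing F q) :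
    HasZeroCoord (algebraMap (CoordRing F q) (FunField F q) f * h)
      (∑ b : Fin q, algebraMap F[X] (RatFunc F) (yCoeff f b) * c b) := by
  have hf : algebraMap (CoordRing F q) (FunField F q) f * h = ∑ b : Fin q,
      ofRatFuncHom F q (algebraMap F[X] (RatFunc F) (yCoeff f b)) *
        (algebraMap (CoordRing F q) (FunField F q) (y ^ (b : ℕ)) * h) := by
    conv_lhs => rw [eq_sum_yCoeff f,
      Finset.sum_range fun b => AdjoinRoot.of (curvePoly F q) (yCoeff f b) * y ^ b, map_sum,
      Finset.sum_mul]
    refine Finset.sum_congr rfl fun b _ => ?_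
    rw [map_mul, algebraMap_of, mul_assoc]
  rw [hf]
  exact HasZeroCoord.sum _ fun b _ => (hc.hasZeroCoord_y_pow_mul b).mul _

/-- The elements of `F[x,y]` have polynomial coordinates. -/
theorem hasZeroCoord_algebraMap (f : CoordRing F q) :
    HasZeroCoord (algebraMap (CoordRing F q) (FunField F q) f)
      (algebraMap F[X] (RatFunc F) (yCoeff f (q - 1))) := by
  have hq := one_lt_q q
  let l : Fin q := ⟨q - 1, by omega⟩
  -- As z∗_(q-1) = 1, the element f is f z∗_(q-1), and duality picks out its polynomial coefficient
  -- at y^(q-1).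
  have hz : (zstar l : CoordRing F q) = 1 := by
    rw [zstar, if_neg (by simp only [l]; omega), Nat.sub_self, pow_zero]
  have h := (isStarExpansion_zstar (F := F) l).hasZeroCoord_mul f
  rw [hz, map_one, mul_one] at h
  convert h using 1
  rw [Finset.sum_eq_single l]
  · rw [Pi.single_eq_same, mul_one]
  · intro b _ hb
    rw [Pi.single_eq_of_ne hb, mul_zero]
  · simp

/-- A leading term of order `aq + q² - 1` is visible in the coordinate at `z∗_0`. -/
theorem HasZeroCoord.laurentCoeff_of_leadAt {h : FunField F q} {u : RatFunc F}
    (hu : HasZeroCoord h u) {a : ℤ} {α : F}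
    (hl : LeadAt (expand F q h) (-(a * q + ((q : ℤ) ^ 2 - 1))) α) : laurentCoeff u a = α := by
  obtain ⟨c, hc, rfl⟩ := hu
  exact (hc.laurentCoeff_of_leadAt hl a (zeroIdx q)).2 (by simp [termOrder, zeroIdx])

end Star

/-! ### The syndrome -/

section SyndCoord

variable {F : Type*} [Field F] [Finite F] {q : ℕ}

/-- The `∗`-coordinates of the syndrome. -/
def syndCoord (e : Point F q → F) (b : Fin q) : RatFunc F :=
  ∑ P : Point F q, RatFunc.C (e P * P.1.2 ^ (b : ℕ)) * (RatFunc.X - RatFunc.C P.1.1)⁻¹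

theorem laurentCoeff_syndCoord (e : Point F q → F) (b : Fin q) (k : ℤ) :
    laurentCoeff (syndCoord e b) (-1 - k) = synd e k b := by
  rw [syndCoord, laurentCoeff_sum, synd]
  simp only [laurentCoeff_C_mul, laurentCoeff_inv_X_sub_C]
  split_ifs with h
  · exact Finset.sum_congr rfl fun P _ => by ring
  · simp

end SyndCoord

section Syndrome

variable {F : Type*} [Field F] {q : ℕ} [Fact (IsPrimePow q)]

/-- The geometric sum of the β^b y^(q-1-b) contributes y^q - β^q, and the extra 1 in z∗_0
contributes y - β. The curve equation at both points does the rest. -/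
theorem y_sub_mul_sum_zstar {α β : F} (h : α ^ (q + 1) = β ^ q + β) :
    ((y : CoordRing F q) - algebraMap F _ β) * ∑ b : Fin q, algebraMap F _ β ^ (b : ℕ) * zstar b =
      x ^ (q + 1) - algebraMap F _ α ^ (q + 1) := by
  have hz (b : Fin q) : algebraMap F (CoordRing F q) β ^ (b : ℕ) * zstar b =
      algebraMap F _ β ^ (b : ℕ) * y ^ (q - 1 - (b : ℕ)) + if b = zeroIdx q then 1 else 0 := by
    rw [zstar]
    by_cases hb : b = zeroIdx q
    · subst hb
      rw [if_pos rfl, if_pos (show ((zeroIdx q : Fin q) : ℕ) = 0 from rfl)]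
      simp [zeroIdx]
    · have hb0 : (b : ℕ) ≠ 0 := fun h => hb (Fin.ext h)
      rw [if_neg hb, if_neg hb0, add_zero]
  rw [Finset.sum_congr rfl fun b _ => hz b, Finset.sum_add_distrib, Finset.sum_ite_eq',
    if_pos (Finset.mem_univ _),
    Fin.sum_univ_eq_sum_range (fun b => algebraMap F (CoordRing F q) β ^ b * y ^ (q - 1 - b)) q,
    x_pow_succ_eq, ← map_pow, h, map_add, map_pow]
  linear_combination -geom_sum₂_mul (algebraMap F (CoordRing F q) β) y q

theorem y_sub_ne_zero (β : F) :
    algebraMap (CoordRing F q) (FunField F q) y - algebraMap F _ β ≠ 0 := by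
  have h := (leadAt_ySeries F q).sub
    ((LeadAt.const β).of_lt (neg_neg_of_pos (by have := q_pos_int q; omega)))
  rw [← expandRing_y, ← expandRing_algebraMap F q, ← map_sub, ← expand_algebraMap, map_sub,
    ← algebraMap_funField] at h
  intro h0
  rw [h0, map_zero, sub_zero] at h
  exact h.ne_zero one_ne_zero rfl

variable [Finite F]

/-- The factor y - β_P of each denominator cancels by `y_sub_mul_sum_zstar`, which leaves ∑ β_P^b
z∗_b / (x - α_P). -/
theorem isStarExpansion_syndrome (e : Point F q → F) :
    IsStarExpansion (syndrome e) (syndCoord e) := by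
  rw [isStarExpansion_iff]
  simp only [syndCoord, map_sum, Finset.sum_mul]
  rw [Finset.sum_comm, syndrome]
  refine Finset.sum_congr rfl fun P _ => ?_
  have hP := congrArg (algebraMap (CoordRing F q) (FunField F q)) (y_sub_mul_sum_zstar P.2)
  rw [map_mul, map_sub, map_sub, map_pow, map_pow, ← algebraMap_funField, ← algebraMap_funField,
    map_sum] at hP
  rw [← hP, mul_comm (_ - algebraMap F (FunField F q) P.1.1),
    mul_div_mul_left _ _ (y_sub_ne_zero P.1.2), Finset.sum_div, Finset.mul_sum]
  refine Finset.sum_congr rfl fun b _ => ?_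
  rw [map_mul, map_mul, map_inv₀, map_sub, ofRatFuncHom_X, ofRatFuncHom_C, ofRatFuncHom_C, map_mul,
    map_pow, map_pow, ← algebraMap_funField]
  ring

theorem exists_isStarExpansion_keyDiff (e : Point F q → F) (f φ : CoordRing F q) :
    ∃ c, IsStarExpansion (keyDiff (syndrome e) f φ) c :=
  let ⟨c, hc, _⟩ := ((isStarExpansion_syndrome e).hasZeroCoord_mul f).sub
    (hasZeroCoord_algebraMap φ)
  ⟨c, hc⟩

/-- The coefficient of the term `x^(-r-1) z∗_j` of `fS` is the discrepancy of `f`. -/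
theorem discrepancy_eq (e : Point F q → F) {f φ : CoordRing F q} {N r : ℤ} {j : Fin q} {α : F}
    (hN : N = termOrder (-1 - r) j)
    (hl : LeadAt (expand F q (keyDiff (syndrome e) f φ)) (-N) α)
    (hφ : StarTermsAtLeast φ (N + 1)) :
    ∑ c ∈ Finset.range q, ∑ a ∈ xSupport (y ^ (j : ℕ) * f) c,
      coef (y ^ (j : ℕ) * f) a c * synd e ((a : ℤ) + r) c = α := by
  obtain ⟨c, hc, hcN⟩ := hφ
  have h1 := (isStarExpansion_syndrome e).hasZeroCoord_mul (y ^ (j : ℕ) * f)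
  have h2 := hc.hasZeroCoord_y_pow_mul j
  have h4 := h1.sub h2
  have hD : algebraMap (CoordRing F q) (FunField F q) (y ^ (j : ℕ) * f) * syndrome e -
      algebraMap (CoordRing F q) (FunField F q) (y ^ (j : ℕ)) * algebraMap _ _ φ =
      algebraMap (CoordRing F q) (FunField F q) (y ^ (j : ℕ)) * keyDiff (syndrome e) f φ := by
    rw [keyDiff, map_mul]
    ring
  rw [hD] at h4
  have h5 := (leadAt_y_pow (F := F) (q := q) j).mul hl
  rw [← expand_algebraMap, ← map_mul, one_mul] at h5
  -- Multiplication by y^j has moved the leading term from x^(-1-r) z∗_j to x^(-1-r) z∗_0, where it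
  -- can be read off.
  have h6 := h4.laurentCoeff_of_leadAt (a := -1 - r) (α := α) (by
    convert h5 using 1
    rw [hN, termOrder]
    ring)
  -- All terms of φ have order above N, so φ does not contribute to the discrepancy.
  have h7 : laurentCoeff (c j) (-1 - r) = 0 := by
    by_contra h
    have := hcN _ _ h
    omega
  rw [laurentCoeff_sub, h7, sub_zero, laurentCoeff_sum] at h6
  rw [← h6, Finset.sum_range]
  refine Finset.sum_congr rfl fun b _ => ?_
  rw [laurentCoeff_algebraMap_mul]
  refine Finset.sum_congr rfl fun a _ => ?_
  rw [← laurentCoeff_syndCoord, show -1 - ((a : ℤ) + r) = -1 - r - a by ring]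
  rfl

end Syndrome

/-! ### Symmetry and cancellation of discrepancies -/

section KeyEquation

theorem keyDiff_mul_sub_mul {F : Type*} [Field F] {q : ℕ} (S : FunField F q) (u v f φ g ψ : CoordRing F q) :
    keyDiff S (u * f - v * g) (u * φ - v * ψ) =
      algebraMap _ _ u * keyDiff S f φ - algebraMap _ _ v * keyDiff S g ψ := by
  simp only [keyDiff, map_sub, map_mul]
  ring

variable {F : Type*} [Field F] {q : ℕ} [Fact (IsPrimePow q)]

theorem leadAt_x_pow_mul {h : FunField F q} {N : ℤ} {α : F}
    (hl : LeadAt (expand F q h) (-N) α) (k : ℕ) :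
    LeadAt (expand F q (algebraMap (CoordRing F q) _ (x ^ k) * h)) (-(k * q + N)) α := by
  have := (leadAt_x_pow (F := F) (q := q) k).mul hl
  rwa [one_mul, ← neg_add, ← expand_algebraMap, ← map_mul] at this

theorem leadAt_C_mul {h : FunField F q} {N : ℤ} {α : F}
    (hl : LeadAt (expand F q h) (-N) α) (c : F) :
    LeadAt (expand F q (algebraMap (CoordRing F q) _ (algebraMap F _ c) * h)) (-N) (c * α) := by
  have := (LeadAt.const c).mul hl
  rwa [zero_add, ← expandRing_algebraMap F q, ← expand_algebraMap, ← map_mul] at this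

/-- Two leading terms of discrepancies of approximate solutions agree when their order is so small
that they cannot be influenced by elements of `F[x,y]`. -/
theorem discrepancy_symm (S : FunField F q) {f φ f' φ' : CoordRing F q} {d d' N N' : ℤ} {α α' : F}
    (hf : LeadAt (expandRing F q f) (-d) 1) (hf' : LeadAt (expandRing F q f') (-d') 1)
    (hD : LeadAt (expand F q (keyDiff S f φ)) (-N) α)
    (hD' : LeadAt (expand F q (keyDiff S f' φ')) (-N') α') {a : ℤ} (ha : a < 0)
    (h1 : d' + N = a * q + ((q : ℤ) ^ 2 - 1)) (h2 : d + N' = a * q + ((q : ℤ) ^ 2 - 1)) :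
    α = α' := by
  have e1 := (hf'.mul hD).sub (by
    convert hf.mul hD' using 1
    rw [← neg_add, ← neg_add, h1, h2])
  rw [← neg_add, h1, one_mul, one_mul, ← expand_algebraMap, ← expand_algebraMap, ← map_mul,
    ← map_mul, ← map_sub] at e1
  -- Cross-multiplication eliminates S and leaves an element of F[x,y], which has no term x^a z∗_0
  -- with a < 0.
  have e2 : algebraMap (CoordRing F q) (FunField F q) f' * keyDiff S f φ -
      algebraMap (CoordRing F q) (FunField F q) f * keyDiff S f' φ' =
      algebraMap (CoordRing F q) (FunField F q) (f * φ' - f' * φ) := by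
    simp only [keyDiff, map_sub, map_mul]
    ring
  rw [e2] at e1
  have e3 := (hasZeroCoord_algebraMap (f * φ' - f' * φ)).laurentCoeff_of_leadAt e1
  rw [laurentCoeff_algebraMap_of_neg _ ha] at e3
  exact (sub_eq_zero.1 e3.symm)

/-- Cancellation of the leading term of `fS - φ` against that of `gS - ψ`. -/
theorem leadAt_cancel (S : FunField F q) {f φ g ψ : CoordRing F q} {d G N M : ℤ} {μ : F} {k l : ℕ}
    (hf : LeadAt (expandRing F q f) (-d) 1) (hg : LeadAt (expandRing F q g) (-G) 0)
    (hD : LeadAt (expand F q (keyDiff S f φ)) (-N) μ)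
    (hE : LeadAt (expand F q (keyDiff S g ψ)) (-M) 1)
    (hφ : StarTermsAtLeast φ (N + 1)) (hψ : StarTermsAtLeast ψ M)
    (hG : (k * q + d : ℤ) = l * q + G) (hM : (k * q + N : ℤ) = l * q + M) :
    LeadAt (expandRing F q (x ^ k * f - algebraMap F _ μ * x ^ l * g)) (-(k * q + d)) 1 ∧
      (∃ ν, LeadAt (expand F q (keyDiff S (x ^ k * f - algebraMap F _ μ * x ^ l * g)
        (x ^ k * φ - algebraMap F _ μ * x ^ l * ψ))) (-(k * q + N - 1)) ν) ∧
      StarTermsAtLeast (x ^ k * φ - algebraMap F _ μ * x ^ l * ψ) (k * q + N) := by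
  refine ⟨?_, ?_, ?_⟩
  · rw [← expand_algebraMap] at hf hg ⊢
    have := (leadAt_x_pow_mul hf k).sub (hG ▸ leadAt_C_mul (leadAt_x_pow_mul hg l) μ)
    rwa [mul_zero, sub_zero, ← map_mul, ← map_mul, ← map_mul, ← mul_assoc,
      ← map_sub, ← map_sub] at this
  · have := (leadAt_x_pow_mul hD k).sub (hM ▸ leadAt_C_mul (leadAt_x_pow_mul hE l) μ)
    rw [mul_one, sub_self, ← mul_assoc, ← map_mul, ← map_sub, ← keyDiff_mul_sub_mul] at this
    -- The coefficients μ and μ · 1 cancel; nothing is known about the next one.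
    obtain ⟨ν, hν⟩ := this.succ
    exact ⟨ν, by rwa [show -(k * q + N - 1 : ℤ) = -(k * q + N) + 1 by ring]⟩
  · rw [sub_eq_add_neg, mul_assoc]
    refine ((hφ.x_pow_mul k).mono (by omega)).add ?_
    exact (((hψ.x_pow_mul l).mono hM.le).smul μ).neg

end KeyEquation

/-! ### The invariant of the algorithm -/

theorem State.p_partner {F : Type*} [Field F] {q : ℕ} [Fact (IsPrimePow q)] (s : State F q) (m : ℕ)
    (i : Fin q) : s.p m (partner m i) = s.p m i := by
  rw [State.p, State.p, partner_partner, add_comm (s.d i)]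

section Invariant

variable {F : Type*} [Field F] [Finite F] {q : ℕ} [Fact (IsPrimePow q)]

/-- The invariant of the algorithm, in terms of the expansions at infinity; `d i` is the order of
`f_i`. -/
structure Invariant (e : Point F q → F) (m : ℕ) (s : State F q) (d : Fin q → ℤ) : Prop where
  lead_f : ∀ i, LeadAt (expandRing F q (s.f i)) (-d i) 1
  modEq : ∀ i, d i ≡ (i : ℕ) [ZMOD q]
  lead_diff : ∀ i, ∃ α, LeadAt (expand F q (keyDiff (syndrome e) (s.f i) (s.φ i)))
    (-((q : ℤ) ^ 2 - q - 1 - (m - d i))) α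
  terms_φ : ∀ i, StarTermsAtLeast (s.φ i) ((q : ℤ) ^ 2 - q - (m - d i))
  lead_aux : ∀ i, LeadAt (expand F q (keyDiff (syndrome e) (s.g i) (s.ψ i)))
    (-((q : ℤ) ^ 2 - 1 - d i)) 1
  terms_ψ : ∀ i, (s.g i ≠ 0 ∧ StarTermsAtLeast (s.ψ i) ((q : ℤ) ^ 2 - d i)) ∨
    (s.g i = 0 ∧ ∃ (a : ℤ) (b : Fin q), a < 0 ∧ d i - q = a * q + (b : ℕ) * (q + 1) ∧
      (s.ψ i = x ^ (-a - 1).toNat * zstar b ∨ s.ψ i = -(x ^ (-a - 1).toNat * zstar b)))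
  lead_g : ∀ i, LeadAt (expandRing F q (s.g i)) (-(m - d i + q)) 0

/-- Each summand has order at most q(q+1) - q - (q+1) = q² - q - 1. -/
theorem expand_syndrome_leadAt (e : Point F q → F) :
    ∃ α, LeadAt (expand F q (syndrome e)) (-((q : ℤ) ^ 2 - q - 1)) α := by
  have hq := q_pos_int q
  rw [syndrome, map_sum]
  suffices h : ∀ s : Finset (Point F q), ∃ α, LeadAt (∑ P ∈ s, expand F q
      (algebraMap F (FunField F q) (e P) *
    ((algebraMap (CoordRing F q) (FunField F q) x ^ (q + 1)
        - algebraMap F (FunField F q) P.1.1 ^ (q + 1)) /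
      ((algebraMap (CoordRing F q) (FunField F q) x - algebraMap F (FunField F q) P.1.1) *
        (algebraMap (CoordRing F q) (FunField F q) y - algebraMap F (FunField F q) P.1.2)))))
      (-((q : ℤ) ^ 2 - q - 1)) α from h _
  have hc (a : F) : LeadAt (expand F q (algebraMap F _ a)) 0 a := by
    rw [algebraMap_funField, expand_algebraMap, expandRing_algebraMap]
    exact LeadAt.const a
  have hx : LeadAt (expand F q (algebraMap (CoordRing F q) _ x)) (-(q : ℤ)) 1 := by
    rw [expand_algebraMap, expandRing_x]
    exact leadAt_xSeries F q
  have hy : LeadAt (expand F q (algebraMap (CoordRing F q) _ y)) (-((q : ℤ) + 1)) 1 := by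
    rw [expand_algebraMap, expandRing_y]
    exact leadAt_ySeries F q
  intro s
  classical
  induction s using Finset.induction_on with
  | empty => exact ⟨0, by simpa using LeadAt.zero _⟩
  | insert P s hP ih =>
    obtain ⟨α, hα⟩ := ih
    rw [Finset.sum_insert hP]
    refine ⟨_, LeadAt.add (a := e P) ?_ hα⟩
    have h1 := (hx.pow (q + 1)).sub (((hc P.1.1).pow (q + 1)).of_lt (n' := ((q + 1 : ℕ) : ℤ) * -q)
      (by push_cast; nlinarith))
    have h2 := hx.sub ((hc P.1.1).of_lt (n' := -(q : ℤ)) (by omega))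
    have h3 := hy.sub ((hc P.1.2).of_lt (n' := -((q : ℤ) + 1)) (by omega))
    have h4 := (hc (e P)).mul (h1.div (h2.mul h3) (by simp))
    simp only [← map_pow, ← map_sub, ← map_mul, ← map_div₀] at h4
    simp only [map_pow] at h4
    convert h4 using 1
    · push_cast
      ring
    · simp

theorem invariant_run_zero (e : Point F q → F) :
    Invariant e 0 (run e 0) fun i => (i : ℕ) * (q + 1) where
  lead_f i := leadAt_y_pow _
  modEq i := Int.modEq_iff_dvd.2 ⟨-(i : ℕ), by ring⟩
  lead_diff i := by
    obtain ⟨α, hα⟩ := expand_syndrome_leadAt e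
    have := (leadAt_y_pow (F := F) (q := q) i).mul hα
    refine ⟨1 * α, ?_⟩
    rw [← expand_algebraMap, ← map_mul] at this
    rw [keyDiff]
    simp only [run, map_zero, sub_zero]
    convert this using 1
    push_cast
    ring
  terms_φ i := StarTermsAtLeast.zero _
  lead_aux i := by
    simp only [run, keyDiff, map_zero, zero_mul, map_neg, zero_sub, neg_neg]
    rw [expand_algebraMap]
    exact leadAt_zstar i
  -- The initial pair 0, -z∗_i is the conventional solution with a = -1 and b = i, for K = i(q+1) -
  -- q = d_i - q.
  terms_ψ i := Or.inr ⟨rfl, -1, i, by norm_num, by ring, Or.inr (by simp [run])⟩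
  lead_g i := by
    simp only [run, map_zero]
    exact LeadAt.zero _

namespace Invariant

variable {e : Point F q → F} {m : ℕ} {s : State F q} {d : Fin q → ℤ}

theorem d_eq (H : Invariant e m s d) (i : Fin q) : s.d i = d i := by
  rw [State.d, ord, rho_eq_of_leadAt (H.lead_f i) one_ne_zero, WithBot.unbotD_coe]

theorem dvd_sum_d_sub (H : Invariant e m s d) (i : Fin q) :
    (q : ℤ) ∣ d i + d (partner m i) - m := by
  refine Int.ModEq.dvd (((H.modEq i).add (H.modEq _)).trans ?_).symm
  exact_mod_cast Int.natCast_modEq_iff.2 (partner_spec m i)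

theorem p_mul (H : Invariant e m s d) (i : Fin q) :
    s.p m i * q = d i + d (partner m i) - m - q := by
  rw [State.p, H.d_eq, H.d_eq, sub_mul, Int.ediv_mul_cancel (H.dvd_sum_d_sub i), one_mul]

theorem r_mul (H : Invariant e m s d) (i : Fin q) :
    s.r m i * q = m - d i - (partner m i : ℕ) * (q + 1) := by
  rw [State.r, H.d_eq, Int.ediv_mul_cancel]
  obtain ⟨u, hu⟩ := H.dvd_sum_d_sub i
  obtain ⟨v, hv⟩ := (H.modEq (partner m i)).dvd
  exact ⟨-u - v - (partner m i : ℕ), by linear_combination -hu - hv⟩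

/-- The allowed order q² - q - 1 - (m - d_i) is that of x^(-1-r_i) z∗_j, so the unspecified
coefficient in the invariant is the computed μ_i. -/
theorem lead_diff_μ (H : Invariant e m s d) (i : Fin q) :
    LeadAt (expand F q (keyDiff (syndrome e) (s.f i) (s.φ i)))
      (-((q : ℤ) ^ 2 - q - 1 - (m - d i))) (s.μ e m i) := by
  obtain ⟨α, hα⟩ := H.lead_diff i
  have : s.μ e m i = α := by
    refine discrepancy_eq e (j := partner m i) ?_ hα ?_
    · rw [termOrder]
      linear_combination H.r_mul i
    · convert H.terms_φ i using 1
      ring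
  rwa [this]

/-- Both cross products f_j(f_i S - φ_i) and f_i(f_j S - φ_j) reach at most the order of x^p z∗_0,
so `discrepancy_symm` applies with a = p. -/
theorem μ_partner (H : Invariant e m s d) {i : Fin q} (hp : s.p m i < 0) :
    s.μ e m (partner m i) = s.μ e m i := by
  have h := H.p_mul i
  exact discrepancy_symm (syndrome e) (H.lead_f _) (H.lead_f _) (H.lead_diff_μ _) (H.lead_diff_μ _)
    hp (by linear_combination -h) (by linear_combination -h)

/-- Whether the orders of `f_i` and `f_j` change depends symmetrically on `i` and its partner
`j`. -/
theorem keep_partner_iff (H : Invariant e m s d) (i : Fin q) :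
    (s.μ e m (partner m i) = 0 ∨ 0 ≤ s.p m (partner m i)) ↔ (s.μ e m i = 0 ∨ 0 ≤ s.p m i) := by
  rw [State.p_partner]
  by_cases hp : 0 ≤ s.p m i
  · simp only [hp, or_true]
  · rw [H.μ_partner (not_le.1 hp)]

/-- A conventional solution with g_i = 0 consists of one term of order exactly q² - 1 - d_i, one
less than the bound for g_i ≠ 0. The weaker bound covers both cases and suffices for the
cancellation. -/
theorem terms_ψ_weak (H : Invariant e m s d) (i : Fin q) :
    StarTermsAtLeast (s.ψ i) ((q : ℤ) ^ 2 - 1 - d i) := by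
  rcases H.terms_ψ i with ⟨-, h⟩ | ⟨-, a, b, ha, hK, hψ⟩
  · exact h.mono (by omega)
  have h := (StarTermsAtLeast.zstar (F := F) b).x_pow_mul (-a - 1).toNat
  rw [Int.toNat_of_nonneg (by omega)] at h
  have h' := h.mono (N' := (q : ℤ) ^ 2 - 1 - d i) (le_of_eq (by linear_combination -hK))
  rcases hψ with hψ | hψ <;> rw [hψ]
  exacts [h', h'.neg]

theorem f_ne_zero (H : Invariant e m s d) (i : Fin q) : s.f i ≠ 0 := by
  intro h
  have := H.lead_f i
  rw [h, map_zero] at this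
  exact this.ne_zero one_ne_zero rfl

end Invariant

/-- The factor x^0 gives both branches the shape x^k f - μ x^l g of `leadAt_cancel`. -/
theorem State.B_of_keep (e : Point F q → F) (s : State F q) (m : ℕ) (i : Fin q)
    (h : s.μ e m i = 0 ∨ 0 ≤ s.p m i) :
    s.B e m i 0 0 = x ^ 0 * s.f i -
        algebraMap F _ (s.μ e m i) * x ^ (s.p m i).toNat * s.g (partner m i) ∧
      s.B e m i 0 1 = x ^ 0 * s.φ i -
        algebraMap F _ (s.μ e m i) * x ^ (s.p m i).toNat * s.ψ (partner m i) ∧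
      s.B e m i 1 0 = s.g (partner m i) ∧ s.B e m i 1 1 = s.ψ (partner m i) := by
  rw [State.B, State.U, if_pos h]
  simp [Matrix.mul_apply, Fin.sum_univ_two, sub_eq_add_neg]

theorem State.B_of_not_keep (e : Point F q → F) (s : State F q) (m : ℕ) (i : Fin q)
    (h : ¬(s.μ e m i = 0 ∨ 0 ≤ s.p m i)) :
    s.B e m i 0 0 = x ^ (-s.p m i).toNat * s.f i -
        algebraMap F _ (s.μ e m i) * x ^ 0 * s.g (partner m i) ∧
      s.B e m i 0 1 = x ^ (-s.p m i).toNat * s.φ i -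
        algebraMap F _ (s.μ e m i) * x ^ 0 * s.ψ (partner m i) ∧
      s.B e m i 1 0 = algebraMap F _ (s.μ e m i)⁻¹ * s.f i ∧
      s.B e m i 1 1 = algebraMap F _ (s.μ e m i)⁻¹ * s.φ i := by
  rw [State.B, State.U, if_neg h]
  simp [Matrix.mul_apply, Fin.sum_univ_two, sub_eq_add_neg]

namespace Invariant

variable {e : Point F q → F} {m : ℕ} {s : State F q} {d : Fin q → ℤ}

/-- The update of `f_i, φ_i` if the order of `f_i` is kept. -/
theorem update_f_of_keep (H : Invariant e m s d) {i : Fin q}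
    (h : s.μ e m i = 0 ∨ 0 ≤ s.p m i) :
    LeadAt (expandRing F q (s.B e m i 0 0)) (-d i) 1 ∧
      (∃ ν, LeadAt (expand F q (keyDiff (syndrome e) (s.B e m i 0 0) (s.B e m i 0 1)))
        (-((q : ℤ) ^ 2 - q - 1 - ((m + 1 : ℕ) - d i))) ν) ∧
      StarTermsAtLeast (s.B e m i 0 1) ((q : ℤ) ^ 2 - q - ((m + 1 : ℕ) - d i)) := by
  obtain ⟨h1, h2, -, -⟩ := State.B_of_keep e s m i h
  rw [h1, h2]
  -- For μ_i = 0 the exponent p may be negative and its truncation meaningless, but the term is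
  -- multiplied by 0.
  by_cases hμ : s.μ e m i = 0
  · have hl := H.lead_diff_μ i
    rw [hμ] at hl
    simp only [hμ, pow_zero, one_mul, map_zero, zero_mul, sub_zero]
    obtain ⟨ν, hν⟩ := hl.succ
    refine ⟨H.lead_f i, ⟨ν, ?_⟩, (H.terms_φ i).mono (by push_cast; omega)⟩
    convert hν using 1
    push_cast
    ring
  · have hp := h.resolve_left hμ
    have hpq := H.p_mul i
    have := leadAt_cancel (syndrome e) (k := 0) (l := (s.p m i).toNat) (H.lead_f i)
      (H.lead_g (partner m i)) (H.lead_diff_μ i) (H.lead_aux (partner m i))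
      ((H.terms_φ i).mono (by omega)) (H.terms_ψ_weak _)
      (by rw [Int.toNat_of_nonneg hp]; push_cast; linear_combination -hpq)
      (by rw [Int.toNat_of_nonneg hp]; push_cast; linear_combination -hpq)
    rw [Nat.cast_zero, zero_mul, zero_add, zero_add] at this
    obtain ⟨a1, ⟨ν, a2⟩, a3⟩ := this
    refine ⟨a1, ⟨ν, ?_⟩, a3.mono (by push_cast; omega)⟩
    convert a2 using 1
    push_cast
    ring

/-- The update of `f_i, φ_i` if the order of `f_i` increases. -/
theorem update_f_of_not_keep (H : Invariant e m s d) {i : Fin q}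
    (h : ¬(s.μ e m i = 0 ∨ 0 ≤ s.p m i)) :
    LeadAt (expandRing F q (s.B e m i 0 0)) (-(m + q - d (partner m i))) 1 ∧
      (∃ ν, LeadAt (expand F q (keyDiff (syndrome e) (s.B e m i 0 0) (s.B e m i 0 1)))
        (-((q : ℤ) ^ 2 - q - 1 - ((m + 1 : ℕ) - (m + q - d (partner m i))))) ν) ∧
      StarTermsAtLeast (s.B e m i 0 1)
        ((q : ℤ) ^ 2 - q - ((m + 1 : ℕ) - (m + q - d (partner m i)))) := by
  obtain ⟨h1, h2, -, -⟩ := State.B_of_not_keep e s m i h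
  rw [h1, h2]
  have hp : 0 ≤ -s.p m i := by
    have := not_le.1 (not_or.1 h).2
    omega
  have hpq := H.p_mul i
  have := leadAt_cancel (syndrome e) (k := (-s.p m i).toNat) (l := 0) (H.lead_f i)
    (H.lead_g (partner m i)) (H.lead_diff_μ i) (H.lead_aux (partner m i))
    ((H.terms_φ i).mono (by omega)) (H.terms_ψ_weak _)
    (by rw [Int.toNat_of_nonneg hp]; push_cast; linear_combination -hpq)
    (by rw [Int.toNat_of_nonneg hp]; push_cast; linear_combination -hpq)
  rw [Int.toNat_of_nonneg hp] at this
  obtain ⟨a1, ⟨ν, a2⟩, a3⟩ := this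
  refine ⟨?_, ⟨ν, ?_⟩, a3.mono (le_of_eq (by push_cast; linear_combination hpq))⟩
  -- The new order is d_i - pq = m + q - d_j, by the definition of p.
  · convert a1 using 1
    linear_combination -hpq
  · convert a2 using 1
    push_cast
    linear_combination -hpq

open Classical in
/-- An iteration preserves the invariant. -/
theorem step (H : Invariant e m s d) :
    Invariant e (m + 1) (s.step e m)
      fun i => if s.μ e m i = 0 ∨ 0 ≤ s.p m i then d i else m + q - d (partner m i) where
  lead_f i := by
    split_ifs with h
    exacts [(H.update_f_of_keep h).1, (H.update_f_of_not_keep h).1]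
  modEq i := by
    split_ifs with h
    · exact H.modEq i
    · refine (Int.modEq_iff_dvd.2 ?_ : _ ≡ d i [ZMOD q]).trans (H.modEq i)
      obtain ⟨u, hu⟩ := H.dvd_sum_d_sub i
      exact ⟨u - 1, by linear_combination hu⟩
  lead_diff i := by
    split_ifs with h
    exacts [(H.update_f_of_keep h).2.1, (H.update_f_of_not_keep h).2.1]
  terms_φ i := by
    split_ifs with h
    exacts [(H.update_f_of_keep h).2.2, (H.update_f_of_not_keep h).2.2]
  lead_aux i := by
    simp only [State.step]
    split_ifs with h
    -- The new g_i comes from the matrix of the partner j, which is in the same case as that of i by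
    -- symmetry.
    · obtain ⟨-, -, h1, h2⟩ := State.B_of_keep e s m _ ((H.keep_partner_iff i).2 h)
      rw [h1, h2, partner_partner]
      exact H.lead_aux i
    · have h' := (H.keep_partner_iff i).not.2 h
      obtain ⟨-, -, h1, h2⟩ := State.B_of_not_keep e s m _ h'
      have hμ := (not_or.1 h').1
      rw [h1, h2]
      -- The new g_i is f_j/μ_j. Division by μ_j makes the difference monic, and its order q² - q -
      -- 1 - (m - d_j) is q² - 1 minus the new d_i = m + q - d_j.
      have := leadAt_C_mul (H.lead_diff_μ (partner m i)) (s.μ e m (partner m i))⁻¹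
      rw [inv_mul_cancel₀ hμ] at this
      have hk := keyDiff_mul_sub_mul (syndrome e) (algebraMap F _ (s.μ e m (partner m i))⁻¹) 0
        (s.f (partner m i)) (s.φ (partner m i)) 0 0
      rw [zero_mul, sub_zero, sub_zero, map_zero, zero_mul, sub_zero] at hk
      rw [hk]
      convert this using 1
      ring
  terms_ψ i := by
    simp only [State.step]
    split_ifs with h
    · obtain ⟨-, -, h1, h2⟩ := State.B_of_keep e s m _ ((H.keep_partner_iff i).2 h)
      rw [h1, h2, partner_partner]
      exact H.terms_ψ i
    · have h' := (H.keep_partner_iff i).not.2 h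
      obtain ⟨-, -, h1, h2⟩ := State.B_of_not_keep e s m _ h'
      have hμ := (not_or.1 h').1
      rw [h1, h2]
      refine Or.inl ⟨mul_ne_zero ?_ (H.f_ne_zero _), ?_⟩
      · exact (map_ne_zero_iff _ (algebraMap F (CoordRing F q)).injective).2 (inv_ne_zero hμ)
      · exact ((H.terms_φ _).smul _).mono (le_of_eq (by ring))
  lead_g i := by
    simp only [State.step]
    split_ifs with h
    · obtain ⟨-, -, h1, -⟩ := State.B_of_keep e s m _ ((H.keep_partner_iff i).2 h)
      rw [h1, partner_partner]
      exact (H.lead_g i).of_lt (by push_cast; omega)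
    · have h' := (H.keep_partner_iff i).not.2 h
      obtain ⟨-, -, h1, -⟩ := State.B_of_not_keep e s m _ h'
      rw [h1]
      have hl := H.lead_f (partner m i)
      rw [← expand_algebraMap] at hl
      have := leadAt_C_mul hl (s.μ e m (partner m i))⁻¹
      rw [← map_mul, expand_algebraMap] at this
      -- With the new d_i, the bound (m + 1) - d_i + q equals d_j + 1, just above the order d_j of
      -- the new g_i.
      exact this.of_lt (by push_cast; omega)

end Invariant

theorem exists_invariant (e : Point F q → F) (m : ℕ) : ∃ d, Invariant e m (run e m) d := by
  induction m with
  | zero => exact ⟨_, invariant_run_zero e⟩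
  | succ m ih => exact ⟨_, ih.choose_spec.step⟩

end Invariant

end

end Hermitian

/-! ### The theorem, read off from the invariant -/

open Hermitian in
theorem mainTheorem2 {F : Type*} [Field F] [Finite F] {q : ℕ} [Fact (IsPrimePow q)]
    (hF : Nat.card F = q ^ 2) (e : Point F q → F) (m : ℕ) (i : Fin q) :
    ∃ d : ℤ, rho ((run e m).f i) = (d : WithBot ℤ) ∧
      IsStarMonic (algebraMap (CoordRing F q) (FunField F q) ((run e m).f i)) ∧
      d ≡ (i : ℕ) [ZMOD q] ∧
      SolvesKeyEq (syndrome e) (m - d) ((run e m).f i) ((run e m).φ i) ∧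
      SolvesKeyEq (syndrome e) (d - q) ((run e m).g i) ((run e m).ψ i) ∧
      IsStarMonic (keyDiff (syndrome e) ((run e m).g i) ((run e m).ψ i)) ∧
      rhoFrac (keyDiff (syndrome e) ((run e m).g i) ((run e m).ψ i)) =
        (((q : ℤ) ^ 2 - 1 - d : ℤ) : WithBot ℤ) ∧
      rho ((run e m).g i) < ((m - d + q : ℤ) : WithBot ℤ) := by
  obtain ⟨d, H⟩ := exists_invariant e m
  have hlead := H.lead_aux i
  refine ⟨d i, rho_eq_of_leadAt (H.lead_f i) one_ne_zero, ?_, H.modEq i, ?_, ?_, ?_,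
    rhoFrac_eq_of_leadAt hlead one_ne_zero, rho_lt_of_leadAt (H.lead_g i)⟩
  · obtain ⟨c, hc, -⟩ := hasZeroCoord_algebraMap ((run e m).f i)
    exact hc.isStarMonic (by rw [expand_algebraMap]; exact H.lead_f i)
  · exact Or.inl ⟨H.f_ne_zero i, rhoFrac_le_of_leadAt (H.lead_diff i).choose_spec, H.terms_φ i⟩
  · rcases H.terms_ψ i with ⟨hg, hψ⟩ | h
    · refine Or.inl ⟨hg, ?_, hψ.mono (le_of_eq (by ring))⟩
      rw [show (q : ℤ) ^ 2 - q - 1 - (d i - q) = (q : ℤ) ^ 2 - 1 - d i by ring]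
      exact rhoFrac_le_of_leadAt hlead
    · exact Or.inr h
  · obtain ⟨c, hc⟩ := exists_isStarExpansion_keyDiff e ((run e m).g i) ((run e m).ψ i)
    exact hc.isStarMonic hlead
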